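/- Let $\mu$ be a Borel probability measure on $\mathbb{R}$ and $T>0$. Let $L_2(T)$ be the space of complex-valued functions that are square integrable for the uniform probability measure on $[0,T]$, with $\|z\|_T^2=\frac1T\int_0^T|z(t)|^2dt$, and let $\|x\|_\mu^2=\int|x|^2\,d\mu$. For $x\in L_2(\mu)$ put $[\mathcal F_\mu^*x](t)=\int_{\mathbb R}x(\xi)e^{2\pi i\xi t}\,d\mu(\xi)$. Define $\mathcal K_\mu:L_2(T)\to L_2(T)$ by $$[\mathcal K_\mu z](t)=\int_{\mathbb R}e^{2\pi i\xi t}\Big[\frac1T\int_0^Tz(s)e^{-2\pi i\xi s}\,ds\Big]d\mu(\xi),$$ and for $\epsilon>0$ let the Fourier statistical dimension be $s_{\mu,\epsilon}=\operatorname{tr}\big(\mathcal K_\mu(\mathcal K_\mu+\epsilon\mathcal I)^{-1}\big)$. A randomized adaptive query algorithm draws a random seed. It then repeatedly either halts and outputs a function $\tilde y$ on $[0,T]$, or queries the value of the observed function at a point of $[0,T]$; each decision depends (jointly measurably) on the seed and the answers so far, and $\tilde y(t)$ depends jointly measurably on these and on $t$. For $C\ge1$ and $\epsilon>0$, such an algorithm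 solves the $(\mu,T,C,\epsilon)$-reconstruction problem (with probability $\ge 2/3$) if for every $x\in L_2(\mu)$ and every fixed measurable, square-integrable noise function $n$ on $[0,T]$, when it queries $y+n$ with $y=\mathcal F_\mu^*x$, its output satisfies, with probability at least $2/3$ over the seed, $$\|y-\tilde y\|_T^2\le\epsilon\|x\|_\mu^2+C\|n\|_T^2 .$$ **Theorem (statistical dimension lower bound).** Suppose $s_{\mu,\epsilon}=O(1/\epsilon^p)$ as $\epsilon\to0^+$ for some constant $p<1$. 1. Let $C\ge1$, and suppose that for each $\epsilon>0$ an algorithm solves the $(\mu,T,C,\epsilon)$-reconstruction problem and makes at most $r_{\mu,\epsilon}\in\mathbb N$ queries on every input $y+n$ and every seed. Then $r_{\mu,\epsilon}=\Omega(s_{\mu,\epsilon})$ in the Hardy–Littlewood sense: $\limsup_{\epsilon\to0^+} r_{\mu,\epsilon}/s_{\mu,\epsilon}>0$. 2. Moreover, there is a constant $c>0$ that does not depend on the algorithm or on $C$ such that for every $\epsilon_0>0$ there is $\epsilon'\in(0,\epsilon_0)$ with the following property: for every $C\ge 1$, any algorithm that solves the $(\mu,T,C,\epsilon')$-reconstruction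 problem and makes at most $r$ queries on every input and every seed has $r\ge c\,s_{\mu,\epsilon'}$. -/

import Mathlib

open MeasureTheory Filter Topology Asymptotics
open scoped ENNReal

/-- The uniform (normalized Lebesgue) measure `(1/T) dt` on `[0, T]`; a probability measure
for `T > 0`, and the zero measure for `T ≤ 0`. -/
noncomputable def uniformTime (T : ℝ) : Measure ℝ :=
  (ENNReal.ofReal T)⁻¹ • volume.restrict (Set.Icc 0 T)

instance uniformTime_isFiniteMeasure (T : ℝ) : IsFiniteMeasure (uniformTime T) := by
  refine ⟨?_⟩
  have h : uniformTime T Set.univ = (ENNReal.ofReal T)⁻¹ * ENNReal.ofReal T := by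
    simp [uniformTime]
  rw [h]
  exact lt_of_le_of_lt (ENNReal.inv_mul_le_one _) ENNReal.one_lt_top

/-- The integral transform `s ↦ ∫ f(t) e^{2πi σ s t} dν(t)`. -/
noncomputable def expTransform (ν : Measure ℝ) (σ : ℝ) (f : ℝ → ℂ) (s : ℝ) : ℂ :=
  ∫ t, f t * Complex.exp (2 * Real.pi * Complex.I * (σ * s * t : ℝ)) ∂ν

/-- The inverse Fourier transform with respect to `μ`: `t ↦ ∫ g(ξ) e^{2πi ξ t} dμ(ξ)`. -/
noncomputable def invFourier (μ : Measure ℝ) (g : ℝ → ℂ) : ℝ → ℂ :=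
  expTransform μ 1 g

theorem norm_exp_kernel (a : ℝ) :
    ‖Complex.exp (2 * Real.pi * Complex.I * (a : ℝ))‖ = 1 := by
  have h : (2 * Real.pi * Complex.I * (a : ℝ) : ℂ) = ((2 * Real.pi * a : ℝ) : ℂ) * Complex.I := by
    push_cast; ring
  rw [h, Complex.norm_exp_ofReal_mul_I]

theorem continuous_exp_kernel (σ : ℝ) :
    Continuous fun q : ℝ × ℝ => Complex.exp (2 * Real.pi * Complex.I * (σ * q.1 * q.2 : ℝ)) := by
  fun_prop

theorem integrable_mul_exp_kernel {ν : Measure ℝ} (σ s : ℝ) {f : ℝ → ℂ} (hf : Integrable f ν) :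
    Integrable (fun t => f t * Complex.exp (2 * Real.pi * Complex.I * (σ * s * t : ℝ))) ν := by
  refine hf.mul_bdd (c := 1) ?_ (ae_of_all _ fun t => (norm_exp_kernel _).le)
  exact Continuous.aestronglyMeasurable (by fun_prop)

theorem norm_expTransform_le (ν : Measure ℝ) (σ s : ℝ) (f : ℝ → ℂ) :
    ‖expTransform ν σ f s‖ ≤ ∫ t, ‖f t‖ ∂ν := by
  refine (norm_integral_le_integral_norm _).trans (le_of_eq ?_)
  simp only [norm_mul, norm_exp_kernel, mul_one]

theorem continuous_expTransform {ν : Measure ℝ} (σ : ℝ) {f : ℝ → ℂ} (hf : Integrable f ν) :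
    Continuous (expTransform ν σ f) := by
  refine continuous_of_dominated (bound := fun t => ‖f t‖) ?_ ?_ hf.norm ?_
  · exact fun s => (integrable_mul_exp_kernel σ s hf).aestronglyMeasurable
  · intro s
    refine ae_of_all _ fun t => ?_
    rw [norm_mul, norm_exp_kernel, mul_one]
  · exact ae_of_all _ fun t => by fun_prop

theorem memLp_expTransform {ν μ : Measure ℝ} [IsFiniteMeasure μ] (σ : ℝ) {f : ℝ → ℂ}
    (hf : Integrable f ν) : MemLp (expTransform ν σ f) 2 μ :=
  MemLp.of_bound (continuous_expTransform σ hf).aestronglyMeasurable _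
    (ae_of_all _ fun s => norm_expTransform_le ν σ s f)

/-- The transform `f ↦ ∫ f(t) e^{2πi σ s t} dν(t)` as a linear map `L²(ν) → L²(μ)`
for finite measures `ν` and `μ`. -/
noncomputable def expLinearMap (ν μ : Measure ℝ) [IsFiniteMeasure ν] [IsFiniteMeasure μ] (σ : ℝ) :
    Lp ℂ 2 ν →ₗ[ℂ] Lp ℂ 2 μ where
  toFun f := (memLp_expTransform (ν := ν) (μ := μ) σ
    ((Lp.memLp f).integrable one_le_two)).toLp (expTransform ν σ f)
  map_add' f g := by
    have hf := (Lp.memLp f).integrable one_le_two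
    have hg := (Lp.memLp g).integrable one_le_two
    have h : expTransform ν σ (f + g : Lp ℂ 2 ν) = expTransform ν σ f + expTransform ν σ g := by
      funext s
      rw [Pi.add_apply]
      unfold expTransform
      rw [← integral_add (integrable_mul_exp_kernel σ s hf) (integrable_mul_exp_kernel σ s hg)]
      refine integral_congr_ae ?_
      filter_upwards [Lp.coeFn_add f g] with t ht
      rw [ht, Pi.add_apply, add_mul]
    rw [← MemLp.toLp_add]
    exact MemLp.toLp_congr _ _ (Eventually.of_forall (congrFun h))
  map_smul' c f := by
    have h : expTransform ν σ (c • f : Lp ℂ 2 ν) = c • expTransform ν σ f := by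
      funext s
      rw [Pi.smul_apply]
      unfold expTransform
      rw [← integral_smul]
      refine integral_congr_ae ?_
      filter_upwards [Lp.coeFn_smul c f] with t ht
      rw [ht, Pi.smul_apply, smul_mul_assoc]
    rw [RingHom.id_apply, ← MemLp.toLp_const_smul]
    exact MemLp.toLp_congr _ _ (Eventually.of_forall (congrFun h))

theorem coeFn_expLinearMap (ν μ : Measure ℝ) [IsFiniteMeasure ν] [IsFiniteMeasure μ] (σ : ℝ)
    (f : Lp ℂ 2 ν) : expLinearMap ν μ σ f =ᵐ[μ] expTransform ν σ f :=
  MemLp.coeFn_toLp (memLp_expTransform (ν := ν) (μ := μ) σ ((Lp.memLp f).integrable one_le_two))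

theorem exists_bound_expLinearMap (ν μ : Measure ℝ) [IsFiniteMeasure ν] [IsFiniteMeasure μ]
    (σ : ℝ) : ∃ C : ℝ, ∀ f, ‖expLinearMap ν μ σ f‖ ≤ C * ‖f‖ := by
  refine ⟨(measureUnivNNReal μ : ℝ) ^ (2 : ℝ≥0∞).toReal⁻¹ *
    (ν Set.univ ^ (1 / (1 : ℝ≥0∞).toReal - 1 / (2 : ℝ≥0∞).toReal)).toReal, fun f => ?_⟩
  have h1 : ∫ t, ‖f t‖ ∂ν ≤
      (ν Set.univ ^ (1 / (1 : ℝ≥0∞).toReal - 1 / (2 : ℝ≥0∞).toReal)).toReal * ‖f‖ := by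
    rw [integral_norm_eq_lintegral_enorm (Lp.aestronglyMeasurable f),
      ← eLpNorm_one_eq_lintegral_enorm, Lp.norm_def, ← ENNReal.toReal_mul, mul_comm]
    refine ENNReal.toReal_mono (ENNReal.mul_ne_top (Lp.eLpNorm_ne_top f) ?_)
      (eLpNorm_le_eLpNorm_mul_rpow_measure_univ one_le_two (Lp.aestronglyMeasurable f))
    exact ENNReal.rpow_ne_top_of_nonneg (by norm_num) (measure_ne_top ν _)
  rw [mul_assoc]
  refine Lp.norm_le_of_ae_bound (by positivity) ?_
  filter_upwards [coeFn_expLinearMap ν μ σ f] with s hs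
  rw [hs]
  exact (norm_expTransform_le ν σ s f).trans h1

/-- The transform `f ↦ ∫ f(t) e^{2πi σ s t} dν(t)` as a bounded operator `L²(ν) → L²(μ)`. -/
noncomputable def expOp (ν μ : Measure ℝ) [IsFiniteMeasure ν] [IsFiniteMeasure μ] (σ : ℝ) :
    Lp ℂ 2 ν →L[ℂ] Lp ℂ 2 μ :=
  (expLinearMap ν μ σ).mkContinuousOfExistsBound (exists_bound_expLinearMap ν μ σ)

theorem coeFn_expOp (ν μ : Measure ℝ) [IsFiniteMeasure ν] [IsFiniteMeasure μ] (σ : ℝ)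
    (f : Lp ℂ 2 ν) : expOp ν μ σ f =ᵐ[μ] expTransform ν σ f :=
  coeFn_expLinearMap ν μ σ f

/-- The kernel operator `K_μ` on `L²([0,T], dt/T)`:
`(K_μ z)(t) = ∫ e^{2πi ξ t} [(1/T) ∫_0^T z(s) e^{-2πi ξ s} ds] dμ(ξ)`. -/
noncomputable def kernelOp (μ : Measure ℝ) [IsFiniteMeasure μ] (T : ℝ) :
    Lp ℂ 2 (uniformTime T) →L[ℂ] Lp ℂ 2 (uniformTime T) :=
  (expOp μ (uniformTime T) 1).comp (expOp (uniformTime T) μ (-1))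

theorem coeFn_kernelOp (μ : Measure ℝ) [IsFiniteMeasure μ] (T : ℝ)
    (z : Lp ℂ 2 (uniformTime T)) :
    kernelOp μ T z =ᵐ[uniformTime T] fun t =>
      ∫ ξ, (∫ s, z s * Complex.exp (2 * Real.pi * Complex.I * (-1 * ξ * s : ℝ)) ∂(uniformTime T))
        * Complex.exp (2 * Real.pi * Complex.I * (1 * t * ξ : ℝ)) ∂μ := by
  refine (coeFn_expOp μ (uniformTime T) 1 _).trans (ae_of_all _ fun t => ?_)
  refine integral_congr_ae ?_
  filter_upwards [coeFn_expOp (uniformTime T) μ (-1) z] with ξ hξ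
  exact congrArg (· * _) hξ

/-- The trace `∑ᵢ ⟨eᵢ, A eᵢ⟩` of an operator on a Hilbert space, along a Hilbert basis.
For trace-class `A` (and for positive `A`) the sum does not depend on the basis. -/
noncomputable def hilbertTrace {H : Type*} [NormedAddCommGroup H] [InnerProductSpace ℂ H]
    [CompleteSpace H] (A : H →L[ℂ] H) : ℂ :=
  ∑' i, inner ℂ ((exists_hilbertBasis ℂ H).choose_spec.choose i)
    (A ((exists_hilbertBasis ℂ H).choose_spec.choose i))

/-- The Fourier statistical dimension `s_{μ,ε} = tr (K_μ (K_μ + ε I)⁻¹)`. For `ε > 0` the operator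
`K_μ + ε I` is invertible because `K_μ` is positive semidefinite, and the trace is real. -/
noncomputable def statDim (μ : Measure ℝ) [IsFiniteMeasure μ] (T ε : ℝ) : ℝ :=
  (hilbertTrace (kernelOp μ T * Ring.inverse (kernelOp μ T + (ε : ℂ) • 1))).re

/-- `‖z‖² = ∫ |z|² dν`, with values in `[0, ∞]`. -/
noncomputable def energy (ν : Measure ℝ) (z : ℝ → ℂ) : ℝ≥0∞ :=
  ∫⁻ t, ‖z t‖ₑ ^ 2 ∂ν

universe u

/-- A randomized adaptive algorithm that observes a function `[0,T] → ℂ` through point queries.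
A random seed is drawn from a probability space. When `k` queries have been answered, the algorithm
sees the seed and the `k` answers; it either halts and outputs a function, or it chooses the next
query point. Everything is jointly measurable in the seed, the answers (and the time argument). -/
structure QueryAlgorithm (T : ℝ) where
  Seed : Type u
  [seedMeasurable : MeasurableSpace Seed]
  law : Measure Seed
  [law_prob : IsProbabilityMeasure law]
  halt : (k : ℕ) → Set (Seed × (Fin k → ℂ))
  query : (k : ℕ) → Seed × (Fin k → ℂ) → ℝ
  output : (k : ℕ) → Seed × (Fin k → ℂ) → ℝ → ℂ
  query_mem : ∀ k v, query k v ∈ Set.Icc 0 T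
  measurableSet_halt : ∀ k, MeasurableSet (halt k)
  measurable_query : ∀ k, Measurable (query k)
  measurable_output : ∀ k, Measurable fun q : (Seed × (Fin k → ℂ)) × ℝ => output k q.1 q.2

attribute [instance] QueryAlgorithm.seedMeasurable QueryAlgorithm.law_prob

namespace QueryAlgorithm

variable {T : ℝ} (A : QueryAlgorithm.{u} T)

/-- The first `k` answers when the observed function is `f` and the seed is `ω`. -/
noncomputable def answers (f : ℝ → ℂ) (ω : A.Seed) : (k : ℕ) → Fin k → ℂ
  | 0 => Fin.elim0
  | k + 1 => Fin.snoc (answers f ω k) (f (A.query k (ω, answers f ω k)))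

/-- On observed function `f` and seed `ω` the algorithm halts after exactly `k` queries. -/
def HaltsAfter (f : ℝ → ℂ) (ω : A.Seed) (k : ℕ) : Prop :=
  (ω, A.answers f ω k) ∈ A.halt k ∧ ∀ j < k, (ω, A.answers f ω j) ∉ A.halt j

/-- On observed function `f` and seed `ω` the algorithm halts, and its output `ỹ` satisfies
`‖y - ỹ‖_T² ≤ B`. -/
def Achieves (f y : ℝ → ℂ) (B : ℝ≥0∞) (ω : A.Seed) : Prop :=
  ∃ k, A.HaltsAfter f ω k ∧
    energy (uniformTime T) (fun t => y t - A.output k (ω, A.answers f ω k) t) ≤ B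

/-- For every signal `y = F_μ^* x` with `x ∈ L²(μ)` and every fixed noise function `n ∈ L²(T)`,
from queries to `y + n` the algorithm outputs, with probability at least `2/3`, some `ỹ` with
`‖y - ỹ‖_T² ≤ ε ‖x‖_μ² + C ‖n‖_T²`. -/
def Solves (μ : Measure ℝ) (C ε : ℝ) : Prop :=
  ∀ x n : ℝ → ℂ, MemLp x 2 μ → Measurable n → MemLp n 2 (uniformTime T) →
    2 / 3 ≤ A.law {ω | A.Achieves (fun t => invFourier μ x t + n t) (invFourier μ x)
      (ENNReal.ofReal ε * energy μ x + ENNReal.ofReal C * energy (uniformTime T) n) ω}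

/-- On every input `y + n` and every seed the algorithm halts after at most `r` queries. -/
def MakesAtMost (μ : Measure ℝ) (r : ℕ) : Prop :=
  ∀ x n : ℝ → ℂ, MemLp x 2 μ → Measurable n → MemLp n 2 (uniformTime T) →
    ∀ ω, ∃ k ≤ r, A.HaltsAfter (fun t => invFourier μ x t + n t) ω k

end QueryAlgorithm

/-- `f(ε) = Ω(g(ε))` as `ε → 0⁺` in the sense of Hardy and Littlewood:
`limsup f(ε) / g(ε) > 0`. -/
def IsHardyLittlewoodOmega (f g : ℝ → ℝ) : Prop :=
  0 < limsup (fun ε => ((f ε / g ε : ℝ) : EReal)) (𝓝[>] (0 : ℝ))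

/-! Write `F` for `expOp` with sign `-1` from `L²(T)` to `L²(μ)`. Then `K_μ = F* F`, and Bessel's
inequality for the characters, integrated over `μ`, shows that `F` is Hilbert–Schmidt. So `K_μ` has
an eigenbasis `vᵢ` with summable eigenvalues `λᵢ ≥ 0`, and `s_{μ,ε} = ∑ λᵢ / (λᵢ + ε)`
(`exists_eigenbasis_kernelOp`).

Query bound (`card_eigenvalues_le`): suppose `m` eigenvalues are at least `12000 ε`. The vectors
`λⱼ^{-1/2} F vⱼ` are orthonormal in `L²(μ)`, and their signals are `√λⱼ vⱼ`. Take a standard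
Gaussian combination of them, without noise. A query imposes two real linear conditions on the
coefficients, so with `r < m / 4` queries the consistent signals form an affine family of dimension
at least `m / 2`, on which the conditional law is still Gaussian. The output is the same for a
signal and its reflection in the centre of that family; it can suit both only if the Gaussian part
is very short, which is unlikely. Success thus has probability below `2/3`, even after averaging
over the seed, so `m ≤ 4 r`.

Counting (`exists_finset_card_ge`): `2 s(ε) - s(ε/2)` is controlled by the number of eigenvalues
above a multiple of `ε`. If this number were small against `s` at all small scales, each halving of
`ε` would multiply `s` by at least some `B > 2^p`, against `s(ε) = O(ε^{-p})`. This needs `p < 1`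
and yields only a sequence of scales, hence the `limsup`. -/

/-! ### Hilbert–Schmidt operators, eigenbases and traces -/

section HilbertSpace

variable {H : Type u} {F : Type*} [NormedAddCommGroup H] [InnerProductSpace ℂ H]
  [NormedAddCommGroup F] [InnerProductSpace ℂ F]

theorem isCompactOperator_smulRight_innerSL (v : H) (w : F) :
    IsCompactOperator ((innerSL ℂ v).smulRight w : H →L[ℂ] F) := by
  have h : IsCompactOperator (innerSL ℂ v : H →L[ℂ] ℂ) :=
    IsCompactOperator.comp_clm (f := (id : ℂ → ℂ))
      (isCompactOperator_id_iff_locallyCompactSpace.mpr inferInstance) (innerSL ℂ v)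
  exact h.clm_comp ((1 : ℂ →L[ℂ] ℂ).smulRight w)

/-- Cauchy–Schwarz splits the tail of the expansion of `A x` into Bessel coefficients of `x` and the
Hilbert–Schmidt tail of `A`. The bound is uniform in `x`, so finite-rank truncations converge in
operator norm. -/
theorem HilbertBasis.norm_map_sub_sum_le {ι : Type*} (e : HilbertBasis ι ℂ H) (A : H →L[ℂ] F)
    {s : Finset ι} {η : ℝ} (hη : 0 ≤ η)
    (h : ∀ t : Finset ι, Disjoint t s → ∑ i ∈ t, ‖A (e i)‖ ^ 2 ≤ η ^ 2) (x : H) :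
    ‖A x - ∑ i ∈ s, inner ℂ (e i) x • A (e i)‖ ≤ η * ‖x‖ := by
  classical
  have hsum : HasSum (fun i => inner ℂ (e i) x • A (e i)) (A x) := by
    have := (e.hasSum_repr x).mapL A
    simpa [e.repr_apply_apply] using this
  have hlim : Tendsto (fun t : Finset ι => ‖∑ i ∈ t, inner ℂ (e i) x • A (e i)
      - ∑ i ∈ s, inner ℂ (e i) x • A (e i)‖) atTop
      (𝓝 ‖A x - ∑ i ∈ s, inner ℂ (e i) x • A (e i)‖) :=
    (Tendsto.sub_const hsum _).norm
  refine le_of_tendsto hlim ?_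
  filter_upwards [eventually_ge_atTop s] with t hst
  rw [← Finset.sum_sdiff hst, add_sub_cancel_right]
  have hB : ∑ i ∈ t \ s, ‖inner ℂ (e i) x‖ ^ 2 ≤ ‖x‖ ^ 2 := e.orthonormal.sum_inner_products_le x
  have hA := h (t \ s) Finset.sdiff_disjoint
  have hCS : (∑ i ∈ t \ s, ‖inner ℂ (e i) x‖ * ‖A (e i)‖) ^ 2 ≤ (η * ‖x‖) ^ 2 :=
    calc _ ≤ (∑ i ∈ t \ s, ‖inner ℂ (e i) x‖ ^ 2) * ∑ i ∈ t \ s, ‖A (e i)‖ ^ 2 :=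
          Finset.sum_mul_sq_le_sq_mul_sq _ _ _
      _ ≤ ‖x‖ ^ 2 * η ^ 2 := by gcongr
      _ = (η * ‖x‖) ^ 2 := by ring
  refine (norm_sum_le _ _).trans ?_
  simp only [norm_smul]
  exact (abs_le_of_sq_le_sq' hCS (by positivity)).2

/-- A Hilbert–Schmidt operator is compact. -/
theorem HilbertBasis.isCompactOperator_of_summable [CompleteSpace F] {ι : Type*}
    (e : HilbertBasis ι ℂ H) (A : H →L[ℂ] F) (h : Summable fun i => ‖A (e i)‖ ^ 2) :
    IsCompactOperator A := by
  have hlim : Tendsto (fun s : Finset ι => ∑ i ∈ s, (innerSL ℂ (e i)).smulRight (A (e i)))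
      atTop (𝓝 A) := by
    classical
    refine Metric.tendsto_atTop.2 fun η hη => ?_
    obtain ⟨s₀, hs₀⟩ := summable_iff_vanishing_norm.1 h ((η / 2) ^ 2) (by positivity)
    refine ⟨s₀, fun s hs => ?_⟩
    rw [dist_comm, dist_eq_norm]
    refine lt_of_le_of_lt (ContinuousLinearMap.opNorm_le_bound _ (half_pos hη).le fun x => ?_)
      (half_lt_self hη)
    have := e.norm_map_sub_sum_le A (s := s) (half_pos hη).le (fun t ht => ?_) x
    · simpa using this
    · refine (le_abs_self _).trans (hs₀ t (ht.mono_right hs)).le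
  refine isCompactOperator_of_tendsto hlim (Eventually.of_forall fun s => ?_)
  exact sum_mem (S := compactOperator (RingHom.id ℂ) H F)
    fun i _ => isCompactOperator_smulRight_innerSL (e i) (A (e i))

/-- A compact symmetric operator has a Hilbert basis of eigenvectors. -/
theorem exists_hilbertBasis_eigenvectors [CompleteSpace H] {K : H →L[ℂ] H}
    (hK : IsCompactOperator K) (hsymm : K.IsSymmetric) :
    ∃ (ι : Type u) (v : HilbertBasis ι ℂ H) (l : ι → ℝ), ∀ i, K (v i) = (l i : ℂ) • v i := by
  let V : ℂ → Submodule ℂ H := fun c => Module.End.eigenspace (K : H →ₗ[ℂ] H) c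
  have hcl : ∀ c, IsClosed (V c : Set H) := by
    intro c
    have : (V c : Set H) = {x | K x = c • x} := by
      ext x
      simp [V]
    rw [this]
    exact isClosed_eq K.continuous (continuous_const_smul c)
  have : ∀ c, CompleteSpace (V c) := fun c => (hcl c).completeSpace_coe
  choose w b hb using fun c => exists_hilbertBasis ℂ (V c)
  have hon : Orthonormal ℂ fun a : Σ c, w c => ((b a.1 a.2 : V a.1) : H) :=
    (LinearMap.IsSymmetric.orthogonalFamily_eigenspaces hsymm).orthonormal_sigma_orthonormal
      fun c => (b c).orthonormal
  -- A vector orthogonal to the basis of every eigenspace is orthogonal to every eigenspace, and the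
  -- spectral theorem leaves only zero. The index `c` runs over all of `ℂ`; a trivial eigenspace
  -- contributes an empty basis.
  have hbot : (Submodule.span ℂ (Set.range fun a : Σ c, w c => ((b a.1 a.2 : V a.1) : H)))ᗮ = ⊥ := by
    rw [eq_bot_iff, ← ContinuousLinearMap.orthogonalComplement_iSup_eigenspaces_eq_bot hK hsymm]
    intro x hx
    rw [Submodule.mem_orthogonal] at hx
    rw [← Submodule.iInf_orthogonal, Submodule.mem_iInf]
    intro c
    rw [Submodule.mem_orthogonal]
    intro y hy
    have h1 := ((b c).hasSum_repr ⟨y, hy⟩).mapL ((innerSL ℂ x).comp (V c).subtypeL)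
    have h2 : ∀ i, ((innerSL ℂ x).comp (V c).subtypeL) ((b c).repr ⟨y, hy⟩ i • b c i) = 0 := by
      intro i
      have h3 := hx _ (Submodule.subset_span ⟨⟨c, i⟩, rfl⟩)
      rw [map_smul]
      simp only [ContinuousLinearMap.comp_apply, innerSL_apply_apply, Submodule.subtypeL_apply]
      rw [inner_eq_zero_symm.1 h3, smul_zero]
    simp only [h2] at h1
    have h4 := h1.unique hasSum_zero
    simp only [ContinuousLinearMap.comp_apply, innerSL_apply_apply, Submodule.subtypeL_apply] at h4
    exact inner_eq_zero_symm.1 h4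
  refine ⟨Σ c, w c, HilbertBasis.mkOfOrthogonalEqBot hon hbot, fun a => a.1.re, fun a => ?_⟩
  rw [HilbertBasis.coe_mkOfOrthogonalEqBot]
  have hmem : K (b a.1 a.2 : V a.1) = a.1 • ((b a.1 a.2 : V a.1) : H) :=
    Module.End.mem_eigenspace_iff.1 (b a.1 a.2).2
  have hev : Module.End.HasEigenvalue (K : H →ₗ[ℂ] H) a.1 :=
    Module.End.hasEigenvalue_of_hasEigenvector (x := ((b a.1 a.2 : V a.1) : H))
      ⟨(b a.1 a.2).2, fun h => by
        have := hon.1 a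
        simp [h] at this⟩
  have hreal := LinearMap.IsSymmetric.conj_eigenvalue_eq_self hsymm hev
  rw [hmem, Complex.conj_eq_iff_re.1 hreal]

theorem HilbertBasis.hasSum_norm_inner_sq {ι : Type*} (e : HilbertBasis ι ℂ H) (x : H) :
    HasSum (fun i => ‖inner ℂ (e i) x‖ ^ 2) (‖x‖ ^ 2) := by
  have h := e.hasSum_inner_mul_inner x x
  rw [inner_self_eq_norm_sq_to_K] at h
  have h2 : ∀ i, inner ℂ x (e i) * inner ℂ (e i) x = ((‖inner ℂ (e i) x‖ ^ 2 : ℝ) : ℂ) := by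
    intro i
    rw [← inner_conj_symm, mul_comm, Complex.mul_conj, Complex.normSq_eq_norm_sq]
  simp only [h2] at h
  refine Complex.hasSum_ofReal.1 ?_
  simpa using h

/-- The trace of a diagonal nonnegative operator is the sum of its eigenvalues. -/
theorem hilbertTrace_of_eigenbasis [CompleteSpace H] {ι : Type*} (v : HilbertBasis ι ℂ H)
    (B : H →L[ℂ] H) {l : ι → ℝ} (hl : ∀ i, 0 ≤ l i) (hsum : Summable l)
    (hB : ∀ i, B (v i) = (l i : ℂ) • v i) :
    hilbertTrace B = ((∑' i, l i : ℝ) : ℂ) := by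
  -- `hilbertTrace` uses an unspecified basis, so the sum is computed in an arbitrary basis `e`. The
  -- double family `lᵢ |⟨eₖ, vᵢ⟩|²` is nonnegative: summed over `i` it gives `⟨eₖ, B eₖ⟩`, summed
  -- over `k` it gives `lᵢ` by Parseval.
  have key : ∀ {κ : Type u} (e : HilbertBasis κ ℂ H),
      HasSum (fun k => inner ℂ (e k) (B (e k))) ((∑' i, l i : ℝ) : ℂ) := by
    intro κ e
    have hterm : ∀ k, HasSum (fun i => l i * ‖inner ℂ (e k) (v i)‖ ^ 2)
        (inner ℂ (e k) (B (e k))).re ∧ (inner ℂ (e k) (B (e k))).im = 0 := by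
      intro k
      have h := ((v.hasSum_repr (e k)).mapL B).mapL (innerSL ℂ (e k))
      have h2 : ∀ i, innerSL ℂ (e k) (B (v.repr (e k) i • v i)) =
          ((l i * ‖inner ℂ (e k) (v i)‖ ^ 2 : ℝ) : ℂ) := by
        intro i
        rw [map_smul, hB, innerSL_apply_apply, inner_smul_right, inner_smul_right,
          v.repr_apply_apply, mul_left_comm, ← inner_conj_symm, mul_comm (starRingEnd ℂ _),
          Complex.mul_conj, Complex.normSq_eq_norm_sq]
        push_cast
        rfl
      simp only [h2] at h
      refine ⟨by simpa only [Complex.ofReal_re, innerSL_apply_apply] using Complex.hasSum_re h, ?_⟩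
      have := (Complex.hasSum_im h)
      simp only [Complex.ofReal_im, innerSL_apply_apply] at this
      exact this.unique hasSum_zero
    have hterm' : ∀ k, inner ℂ (e k) (B (e k)) =
        ((∑' i, l i * ‖inner ℂ (e k) (v i)‖ ^ 2 : ℝ) : ℂ) := by
      intro k
      apply Complex.ext
      · rw [Complex.ofReal_re, (hterm k).1.tsum_eq]
      · rw [Complex.ofReal_im, (hterm k).2]
    simp only [hterm']
    rw [Complex.hasSum_ofReal]
    have hcol : ∀ i, HasSum (fun k => l i * ‖inner ℂ (e k) (v i)‖ ^ 2) (l i) := by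
      intro i
      have h := (e.hasSum_norm_inner_sq (v i)).mul_left (l i)
      rwa [v.orthonormal.1 i, one_pow, mul_one] at h
    have hprod : Summable fun q : ι × κ => l q.1 * ‖inner ℂ (e q.2) (v q.1)‖ ^ 2 := by
      rw [summable_prod_of_nonneg (fun q => mul_nonneg (hl _) (by positivity))]
      refine ⟨fun i => (hcol i).summable, ?_⟩
      simpa only [(hcol _).tsum_eq] using hsum
    have h1 := hprod.hasSum.prod_fiberwise hcol
    have h2 := (hprod.prod_symm.hasSum).prod_fiberwise
      (fun k => ((hterm k).1.summable.hasSum))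
    have h3 : ∑' q : κ × ι, l q.swap.1 * ‖inner ℂ (e q.swap.2) (v q.swap.1)‖ ^ 2
        = ∑' q : ι × κ, l q.1 * ‖inner ℂ (e q.2) (v q.1)‖ ^ 2 :=
      (Equiv.prodComm κ ι).tsum_eq (fun q : ι × κ => l q.1 * ‖inner ℂ (e q.2) (v q.1)‖ ^ 2)
    rw [h3, ← h1.tsum_eq] at h2
    exact h2
  exact (key _).tsum_eq

end HilbertSpace

/-! ### Spectrum of the kernel operator -/

section Transform

theorem expTransform_congr_ae {ν : Measure ℝ} {σ : ℝ} {f g : ℝ → ℂ} (h : f =ᵐ[ν] g) :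
    expTransform ν σ f = expTransform ν σ g := by
  funext s
  refine integral_congr_ae ?_
  filter_upwards [h] with t ht
  rw [ht]

theorem conj_exp_kernel (a : ℝ) :
    (starRingEnd ℂ) (Complex.exp (2 * Real.pi * Complex.I * (a : ℝ)))
      = Complex.exp (2 * Real.pi * Complex.I * (-a : ℝ)) := by
  rw [← Complex.exp_conj]
  congr 1
  simp [Complex.conj_ofNat]

/-- Fubini, valid because `x(ξ) conj z(t)` is integrable on the product and the kernel has modulus
one. The two transforms are thus adjoint, which gives `kernelOp` the form `F* F`. -/
theorem inner_expOp_left (ν μ : Measure ℝ) [IsFiniteMeasure ν] [IsFiniteMeasure μ]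
    (z : Lp ℂ 2 ν) (x : Lp ℂ 2 μ) :
    inner ℂ (expOp ν μ (-1) z) x = inner ℂ z (expOp μ ν 1 x) := by
  have hz := (Lp.memLp z).integrable one_le_two
  have hx := (Lp.memLp x).integrable one_le_two
  rw [L2.inner_def, L2.inner_def]
  have h1 : ∫ ξ, inner ℂ (expOp ν μ (-1) z ξ) (x ξ) ∂μ
      = ∫ ξ, ∫ t, x ξ * (starRingEnd ℂ) (z t)
        * Complex.exp (2 * Real.pi * Complex.I * (ξ * t : ℝ)) ∂ν ∂μ := by
    refine integral_congr_ae ?_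
    filter_upwards [coeFn_expOp ν μ (-1) z] with ξ hξ
    rw [hξ, RCLike.inner_apply, expTransform, ← integral_conj, ← integral_const_mul]
    refine integral_congr_ae (ae_of_all _ fun t => ?_)
    simp only [map_mul, conj_exp_kernel]
    rw [← mul_assoc]
    congr 3
    push_cast
    ring
  have h2 : ∫ t, inner ℂ (z t) (expOp μ ν 1 x t) ∂ν
      = ∫ t, ∫ ξ, x ξ * (starRingEnd ℂ) (z t)
        * Complex.exp (2 * Real.pi * Complex.I * (ξ * t : ℝ)) ∂μ ∂ν := by
    refine integral_congr_ae ?_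
    filter_upwards [coeFn_expOp μ ν 1 x] with t ht
    rw [ht, RCLike.inner_apply, expTransform, ← integral_mul_const]
    refine integral_congr_ae (ae_of_all _ fun ξ => ?_)
    simp only
    rw [mul_right_comm]
    congr 4
    ring
  rw [h1, h2]
  refine integral_integral_swap ?_
  have h3 : Integrable (fun q : ℝ × ℝ => x q.1 * (starRingEnd ℂ) (z q.2)) (μ.prod ν) := by
    refine hx.mul_prod (g := fun t => (starRingEnd ℂ) (z t)) ?_
    refine (integrable_norm_iff
      (Complex.continuous_conj.comp_aestronglyMeasurable hz.aestronglyMeasurable)).1 ?_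
    simpa using hz.norm
  refine h3.mul_bdd (c := 1) ?_ (ae_of_all _ fun q => (norm_exp_kernel _).le)
  exact Continuous.aestronglyMeasurable (by fun_prop)

theorem kernelOp_apply (μ : Measure ℝ) [IsFiniteMeasure μ] (T : ℝ) (z : Lp ℂ 2 (uniformTime T)) :
    kernelOp μ T z = expOp μ (uniformTime T) 1 (expOp (uniformTime T) μ (-1) z) := rfl

theorem inner_kernelOp_right (μ : Measure ℝ) [IsFiniteMeasure μ] (T : ℝ)
    (z w : Lp ℂ 2 (uniformTime T)) :
    inner ℂ z (kernelOp μ T w)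
      = inner ℂ (expOp (uniformTime T) μ (-1) z) (expOp (uniformTime T) μ (-1) w) := by
  rw [kernelOp_apply, inner_expOp_left]

theorem isSymmetric_kernelOp (μ : Measure ℝ) [IsFiniteMeasure μ] (T : ℝ) :
    (kernelOp μ T).IsSymmetric := by
  intro z w
  change inner ℂ (kernelOp μ T z) w = inner ℂ z (kernelOp μ T w)
  rw [← inner_conj_symm, inner_kernelOp_right, inner_conj_symm, inner_kernelOp_right]

theorem memLp_character (ν : Measure ℝ) [IsFiniteMeasure ν] (ξ : ℝ) :
    MemLp (fun t : ℝ => Complex.exp (2 * Real.pi * Complex.I * (ξ * t : ℝ))) 2 ν :=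
  MemLp.of_bound (Continuous.aestronglyMeasurable (by fun_prop)) 1
    (ae_of_all _ fun _ => (norm_exp_kernel _).le)

/-- As a coefficient against a character, the transform is open to Bessel's inequality at each fixed
frequency. -/
theorem expTransform_neg_one_eq_inner (ν : Measure ℝ) [IsFiniteMeasure ν] (ξ : ℝ)
    (z : Lp ℂ 2 ν) : expTransform ν (-1) z ξ = inner ℂ ((memLp_character ν ξ).toLp _) z := by
  rw [L2.inner_def, expTransform]
  refine integral_congr_ae ?_
  filter_upwards [(memLp_character ν ξ).coeFn_toLp] with t ht
  rw [ht, RCLike.inner_apply, conj_exp_kernel]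
  simp

theorem norm_toLp_character_sq_le (ν : Measure ℝ) [IsProbabilityMeasure ν] (ξ : ℝ) :
    ‖(memLp_character ν ξ).toLp _‖ ^ 2 ≤ 1 := by
  refine pow_le_one₀ (norm_nonneg _) ?_
  have := Lp.norm_le_of_ae_bound (f := (memLp_character ν ξ).toLp _) (C := 1) zero_le_one (by
    filter_upwards [(memLp_character ν ξ).coeFn_toLp] with t ht
    rw [ht]
    exact (norm_exp_kernel _).le)
  simpa [measureUnivNNReal] using this

theorem norm_sq_eq_integral {ν : Measure ℝ} (z : Lp ℂ 2 ν) : ‖z‖ ^ 2 = ∫ t, ‖z t‖ ^ 2 ∂ν := by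
  have h := L2.inner_def (𝕜 := ℂ) z z
  rw [inner_self_eq_norm_sq_to_K] at h
  have h2 : ∀ t, inner ℂ (z t) (z t) = ((‖z t‖ ^ 2 : ℝ) : ℂ) := by
    intro t
    rw [inner_self_eq_norm_sq_to_K]
    simp
  simp only [h2, integral_complex_ofReal] at h
  apply Complex.ofReal_injective
  simpa using h

/-- Bessel's inequality for the characters: the operator `F_μ` is Hilbert–Schmidt. -/
theorem sum_norm_expOp_sq_le (ν μ : Measure ℝ) [IsProbabilityMeasure ν] [IsProbabilityMeasure μ]
    {ι : Type*} {e : ι → Lp ℂ 2 ν} (he : Orthonormal ℂ e) (s : Finset ι) :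
    ∑ i ∈ s, ‖expOp ν μ (-1) (e i)‖ ^ 2 ≤ 1 := by
  have h1 : ∀ i, Integrable (fun ξ => ‖expOp ν μ (-1) (e i) ξ‖ ^ 2) μ := fun i =>
    (Lp.memLp (expOp ν μ (-1) (e i))).integrable_norm_pow (by norm_num)
  simp only [norm_sq_eq_integral]
  rw [← integral_finsetSum _ fun i _ => h1 i]
  have h2 : ∀ᵐ ξ ∂μ, ∑ i ∈ s, ‖expOp ν μ (-1) (e i) ξ‖ ^ 2 ≤ 1 := by
    have h3 : ∀ᵐ ξ ∂μ, ∀ i ∈ s, expOp ν μ (-1) (e i) ξ = expTransform ν (-1) (e i) ξ :=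
      (ae_ball_iff s.countable_toSet).2 fun i _ => coeFn_expOp ν μ (-1) (e i)
    filter_upwards [h3] with ξ hξ
    refine le_trans (le_of_eq (Finset.sum_congr rfl fun i hi => ?_))
      ((he.sum_inner_products_le ((memLp_character ν ξ).toLp _) (s := s)).trans
        (norm_toLp_character_sq_le ν ξ))
    rw [hξ i hi, expTransform_neg_one_eq_inner, norm_inner_symm]
  refine (integral_mono_ae (integrable_finsetSum _ fun i _ => h1 i) (integrable_const 1) h2).trans ?_
  simp

theorem summable_norm_expOp_sq (ν μ : Measure ℝ) [IsProbabilityMeasure ν] [IsProbabilityMeasure μ]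
    {ι : Type*} {e : ι → Lp ℂ 2 ν} (he : Orthonormal ℂ e) :
    Summable fun i => ‖expOp ν μ (-1) (e i)‖ ^ 2 :=
  summable_of_sum_le (fun _ => by positivity) (sum_norm_expOp_sq_le ν μ he)

theorem isProbabilityMeasure_uniformTime {T : ℝ} (hT : 0 < T) :
    IsProbabilityMeasure (uniformTime T) := by
  refine ⟨?_⟩
  have h : ENNReal.ofReal T ≠ 0 := by simpa using hT
  simp [uniformTime, ENNReal.inv_mul_cancel h]

theorem isCompactOperator_kernelOp (μ : Measure ℝ) [IsProbabilityMeasure μ] {T : ℝ} (hT : 0 < T) :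
    IsCompactOperator (kernelOp μ T) := by
  have := isProbabilityMeasure_uniformTime hT
  obtain ⟨w, e, -⟩ := exists_hilbertBasis ℂ (Lp ℂ 2 (uniformTime T))
  exact (e.isCompactOperator_of_summable (expOp (uniformTime T) μ (-1))
    (summable_norm_expOp_sq _ _ e.orthonormal)).clm_comp (expOp μ (uniformTime T) 1)

theorem uniformTime_ne_zero_of_isOpen {T : ℝ} (hT : 0 < T) {U : Set ℝ} (hU : IsOpen U)
    (h0 : (0 : ℝ) ∈ U) : uniformTime T U ≠ 0 := by
  have h1 : 0 < volume (U ∩ Set.Ioo 0 T) := by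
    refine (hU.inter isOpen_Ioo).measure_pos volume ?_
    have := mem_closure_iff.1 (by rw [closure_Ioo hT.ne]; exact ⟨le_rfl, hT.le⟩ :
      (0 : ℝ) ∈ closure (Set.Ioo 0 T)) U hU h0
    exact this
  have h2 : 0 < volume.restrict (Set.Icc 0 T) U := by
    rw [Measure.restrict_apply hU.measurableSet]
    exact h1.trans_le (measure_mono (Set.inter_subset_inter_right _ Set.Ioo_subset_Icc_self))
  rw [uniformTime, Measure.smul_apply, smul_eq_mul]
  exact mul_ne_zero (by simp) h2.ne'

/-- If `F* F = 0` then `F` and `F*` vanish. But `F*` of the constant `1` is continuous with value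
`μ(ℝ) = 1` at `t = 0`, hence nonzero on a set of positive measure. This provides a positive
eigenvalue, so that `statDim` is positive. -/
theorem kernelOp_ne_zero (μ : Measure ℝ) [IsProbabilityMeasure μ] {T : ℝ} (hT : 0 < T) :
    kernelOp μ T ≠ 0 := by
  intro hK
  have hG : ∀ z, expOp (uniformTime T) μ (-1) z = 0 := by
    intro z
    have := inner_kernelOp_right μ T z z
    rw [hK] at this
    simpa using this.symm
  have hG' : ∀ x, expOp μ (uniformTime T) 1 x = 0 := by
    intro x
    have := inner_expOp_left (uniformTime T) μ (expOp μ (uniformTime T) 1 x) x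
    rw [hG] at this
    simpa using this.symm
  have h1 : MemLp (fun _ : ℝ => (1 : ℂ)) 2 μ := memLp_const 1
  have h2 := coeFn_expOp μ (uniformTime T) 1 (h1.toLp _)
  rw [hG', expTransform_congr_ae h1.coeFn_toLp] at h2
  have hcont : Continuous (expTransform μ 1 fun _ => (1 : ℂ)) :=
    continuous_expTransform 1 (integrable_const 1)
  have hopen : IsOpen {t | expTransform μ 1 (fun _ => (1 : ℂ)) t ≠ 0} :=
    isOpen_ne_fun hcont continuous_const
  refine uniformTime_ne_zero_of_isOpen hT hopen ?_ ?_
  · simp [expTransform]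
  · change ∀ᵐ t ∂(uniformTime T), expTransform μ 1 (fun _ => (1 : ℂ)) t = 0
    filter_upwards [h2, Lp.coeFn_zero ℂ 2 (uniformTime T)] with t ht ht0
    rw [← ht, ht0]
    simp

/-- Coercivity: `⟨(K + ε) z, z⟩ = ‖F z‖² + ε ‖z‖² ≥ ε ‖z‖²`. -/
theorem isUnit_kernelOp_add (μ : Measure ℝ) [IsFiniteMeasure μ] (T : ℝ) {ε : ℝ} (hε : 0 < ε) :
    IsUnit (kernelOp μ T + (ε : ℂ) • 1) := by
  refine ContinuousLinearMap.isUnit_of_forall_le_norm_inner_map _ (c := ⟨ε, hε.le⟩) hε fun z => ?_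
  have h : inner ℂ ((kernelOp μ T + (ε : ℂ) • 1) z) z
      = ((‖expOp (uniformTime T) μ (-1) z‖ ^ 2 + ε * ‖z‖ ^ 2 : ℝ) : ℂ) := by
    rw [← inner_conj_symm]
    simp only [_root_.add_apply, _root_.smul_apply,
      one_apply_eq_self, inner_add_right, inner_smul_right, inner_kernelOp_right,
      inner_self_eq_norm_sq_to_K]
    simp
  rw [h, Complex.norm_real, Real.norm_of_nonneg (by positivity)]
  change ‖z‖ ^ 2 * ε ≤ _
  nlinarith [sq_nonneg ‖expOp (uniformTime T) μ (-1) z‖]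

theorem ringInverse_apply_of_eigenvector {H : Type*} [NormedAddCommGroup H] [InnerProductSpace ℂ H]
    {A : H →L[ℂ] H} (hA : IsUnit A) {c : ℂ} (hc : c ≠ 0) {v : H} (hv : A v = c • v) :
    Ring.inverse A v = c⁻¹ • v := by
  have h : (Ring.inverse A * A) v = v := by rw [Ring.inverse_mul_cancel A hA]; rfl
  rw [mul_apply_eq_comp, hv, map_smul] at h
  rw [← h, smul_smul, inv_mul_cancel₀ hc, one_smul, h]

/-- The spectral decomposition of the kernel operator, and the statistical dimension in terms of
its eigenvalues. -/
theorem exists_eigenbasis_kernelOp (μ : Measure ℝ) [IsProbabilityMeasure μ] {T : ℝ} (hT : 0 < T) :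
    ∃ (ι : Type) (v : HilbertBasis ι ℂ (Lp ℂ 2 (uniformTime T))) (l : ι → ℝ),
      (∀ i, kernelOp μ T (v i) = (l i : ℂ) • v i) ∧ (∀ i, 0 ≤ l i) ∧ Summable l ∧
      (∃ i, 0 < l i) ∧ ∀ ε : ℝ, 0 < ε → statDim μ T ε = ∑' i, l i / (l i + ε) := by
  have := isProbabilityMeasure_uniformTime hT
  obtain ⟨ι, v, l, hv⟩ := exists_hilbertBasis_eigenvectors (isCompactOperator_kernelOp μ hT)
    (isSymmetric_kernelOp μ T)
  have hl : ∀ i, l i = ‖expOp (uniformTime T) μ (-1) (v i)‖ ^ 2 := by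
    intro i
    have h := inner_kernelOp_right μ T (v i) (v i)
    rw [hv, inner_smul_right, inner_self_eq_norm_sq_to_K, inner_self_eq_norm_sq_to_K,
      v.orthonormal.1 i] at h
    apply Complex.ofReal_injective
    simpa using h
  have hl0 : ∀ i, 0 ≤ l i := fun i => by rw [hl]; positivity
  have hsum : Summable l := by
    simpa only [← hl] using summable_norm_expOp_sq (uniformTime T) μ v.orthonormal
  refine ⟨ι, v, l, hv, hl0, hsum, ?_, fun ε hε => ?_⟩
  · by_contra! hcon
    refine kernelOp_ne_zero μ hT (ContinuousLinearMap.ext fun z => ?_)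
    have h := (v.hasSum_repr z).mapL (kernelOp μ T)
    have h0 : ∀ i, kernelOp μ T (v.repr z i • v i) = 0 := by
      intro i
      rw [map_smul, hv, le_antisymm (hcon i) (hl0 i)]
      simp
    simp only [h0] at h
    exact h.unique hasSum_zero
  · have hpos : ∀ i, 0 < l i + ε := fun i => by linarith [hl0 i]
    rw [statDim, hilbertTrace_of_eigenbasis v _ (l := fun i => l i / (l i + ε))
      (fun i => div_nonneg (hl0 i) (hpos i).le), Complex.ofReal_re]
    · refine Summable.of_nonneg_of_le (fun i => div_nonneg (hl0 i) (hpos i).le) (fun i => ?_)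
        (hsum.div_const ε)
      have := hl0 i
      gcongr
      linarith
    · intro i
      have hne : ((l i + ε : ℝ) : ℂ) ≠ 0 := Complex.ofReal_ne_zero.2 (hpos i).ne'
      have h1 : (kernelOp μ T + (ε : ℂ) • 1) (v i) = ((l i + ε : ℝ) : ℂ) • v i := by
        rw [_root_.add_apply, _root_.smul_apply, one_apply_eq_self, hv, ← add_smul,
          Complex.ofReal_add]
      rw [mul_apply_eq_comp,
        ringInverse_apply_of_eigenvector (isUnit_kernelOp_add μ T hε) hne h1, map_smul, hv,
        smul_smul]
      congr 1
      push_cast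
      rw [div_eq_inv_mul]

end Transform

/-! ### Large eigenvalues against the statistical dimension -/

section EigenvalueCounting

variable {ι : Type*} {l : ι → ℝ}

theorem summable_div_add (hl : ∀ i, 0 ≤ l i) (hsum : Summable l) {ε : ℝ} (hε : 0 < ε) :
    Summable fun i => l i / (l i + ε) := by
  refine Summable.of_nonneg_of_le (fun i => div_nonneg (hl i) (by linarith [hl i])) (fun i => ?_)
    (hsum.div_const ε)
  have := hl i
  gcongr
  linarith

theorem tsum_div_add_pos (hl : ∀ i, 0 ≤ l i) (hsum : Summable l) (hpos : ∃ i, 0 < l i) {ε : ℝ}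
    (hε : 0 < ε) : 0 < ∑' i, l i / (l i + ε) := by
  obtain ⟨i, hi⟩ := hpos
  exact (summable_div_add hl hsum hε).tsum_pos
    (fun i => div_nonneg (hl i) (by linarith [hl i])) i (by positivity)

/-- Termwise, since `λ + a ε ≥ a (λ + ε)` when `a ≤ 1`. -/
theorem tsum_div_add_le_mul (hl : ∀ i, 0 ≤ l i) (hsum : Summable l) {a ε : ℝ} (hε : 0 < ε)
    (ha : 0 < a) (ha1 : a ≤ 1) :
    ∑' i, l i / (l i + a * ε) ≤ a⁻¹ * ∑' i, l i / (l i + ε) := by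
  rw [← tsum_mul_left]
  refine (summable_div_add hl hsum (by positivity)).tsum_le_tsum (fun i => ?_)
    ((summable_div_add hl hsum hε).mul_left _)
  have := hl i
  rw [inv_mul_eq_div, div_div]
  gcongr
  nlinarith

/-- Comparing the statistical dimension at `ε` and at `ε / 2`, the loss against exact doubling
is controlled by the number of eigenvalues above `κ ε / 2`. -/
theorem two_mul_tsum_div_add_sub_le (hl : ∀ i, 0 ≤ l i) (hsum : Summable l) {ε κ : ℝ}
    (hε : 0 < ε) (hκ : 0 < κ) (F : Finset ι) (hF : ∀ i ∉ F, l i ≤ κ * (ε / 2)) :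
    2 * ∑' i, l i / (l i + ε) - ∑' i, l i / (l i + ε / 2)
      ≤ F.card + κ * ∑' i, l i / (l i + ε) := by
  classical
  have h1 := summable_div_add hl hsum hε
  have h2 := summable_div_add hl hsum (half_pos hε)
  have h3 : HasSum (fun i => if i ∈ F then (1 : ℝ) else 0) F.card := by
    have : HasSum (fun i => if i ∈ F then (1 : ℝ) else 0) (∑ i ∈ F, if i ∈ F then (1 : ℝ) else 0) :=
      hasSum_sum_of_ne_finset_zero (by intro b hb; simp [hb])
    simpa using this
  rw [← tsum_mul_left, ← tsum_mul_left, ← h3.tsum_eq,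
    ← (h1.mul_left 2).tsum_sub h2, ← h3.summable.tsum_add (h1.mul_left κ)]
  refine ((h1.mul_left 2).sub h2).tsum_le_tsum (fun i => ?_) (h3.summable.add (h1.mul_left κ))
  have hi := hl i
  -- The doubling defect is a product of two factors in `[0, 1]`: at most `1` on `F`, while off `F`
  -- the second factor is at most `κ`.
  have e : 2 * (l i / (l i + ε)) - l i / (l i + ε / 2)
      = (l i / (l i + ε)) * (l i / (l i + ε / 2)) := by
    field_simp
    ring
  have hu0 : 0 ≤ l i / (l i + ε) := by positivity
  have hu1 : l i / (l i + ε) ≤ 1 := (div_le_one (by positivity)).2 (by linarith)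
  have hv0 : 0 ≤ l i / (l i + ε / 2) := by positivity
  have hv1 : l i / (l i + ε / 2) ≤ 1 := (div_le_one (by positivity)).2 (by linarith)
  rw [e]
  by_cases hiF : i ∈ F
  · rw [if_pos hiF]
    have : (l i / (l i + ε)) * (l i / (l i + ε / 2)) ≤ 1 := mul_le_one₀ hu1 hv0 hv1
    nlinarith [mul_nonneg hκ.le hu0]
  · rw [if_neg hiF, zero_add, mul_comm]
    refine mul_le_mul_of_nonneg_right ?_ hu0
    rw [div_le_iff₀ (by positivity)]
    nlinarith [hF i hiF, mul_nonneg hκ.le hi]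

theorem finite_setOf_le_of_summable (hsum : Summable l) {τ : ℝ} (hτ : 0 < τ) :
    {i | τ ≤ l i}.Finite := by
  have h := hsum.tendsto_cofinite_zero.eventually (gt_mem_nhds hτ)
  rw [Filter.eventually_cofinite] at h
  simpa using h

/-- If `∑ λᵢ / (λᵢ + ε) = O(ε⁻ᵖ)` with `p < 1`, then at arbitrarily small scales `ε` a constant
fraction of this sum is accounted for by the eigenvalues `λᵢ ≥ C ε`. -/
theorem exists_finset_card_ge (hl : ∀ i, 0 ≤ l i) (hsum : Summable l) (hpos : ∃ i, 0 < l i)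
    {p : ℝ} (hp : p < 1)
    (hO : (fun ε : ℝ => ∑' i, l i / (l i + ε)) =O[𝓝[>] 0] (fun ε : ℝ => 1 / ε ^ p))
    {C : ℝ} (hC : 1 ≤ C) :
    ∃ c : ℝ, 0 < c ∧ ∀ ε₀ : ℝ, 0 < ε₀ → ∃ ε : ℝ, 0 < ε ∧ ε < ε₀ ∧
      ∃ F : Finset ι, (∀ i ∈ F, C * ε ≤ l i) ∧ c * ∑' i, l i / (l i + ε) ≤ F.card := by
  set s : ℝ → ℝ := fun ε => ∑' i, l i / (l i + ε) with hs
  have hspos : ∀ {ε : ℝ}, 0 < ε → 0 < s ε := fun hε => tsum_div_add_pos hl hsum hpos hε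
  have h2p : (2 : ℝ) ^ p < 2 := by
    simpa using Real.rpow_lt_rpow_of_exponent_lt (x := 2) (by norm_num) hp
  have h2p0 : (0 : ℝ) < 2 ^ p := by positivity
  -- Any growth factor strictly between `2^p` and `2` would do. With `κ` as below, `2 - κ = B + κ`.
  set B : ℝ := (2 + 2 ^ p) / 2 with hB
  have hBp : (2 : ℝ) ^ p < B := by rw [hB]; linarith
  have hB2 : B < 2 := by rw [hB]; linarith
  have hB0 : 0 < B := h2p0.trans hBp
  set κ : ℝ := (2 - B) / 2 with hκ
  have hκ0 : 0 < κ := by rw [hκ]; linarith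
  have hκ1 : κ < 1 := by rw [hκ]; linarith
  set a : ℝ := κ / C with ha
  have hC0 : 0 < C := by linarith
  have ha0 : 0 < a := by positivity
  have ha1 : a ≤ 1 := (div_le_one hC0).2 (by linarith)
  -- the constant makes `(2 - κ) / (1 + c / a) = B`
  set c : ℝ := a * κ / B with hc
  have hc0 : 0 < c := by positivity
  refine ⟨c, hc0, fun ε₀ hε₀ => ?_⟩
  by_contra! hcon
  have hstep : ∀ ε : ℝ, 0 < ε → ε < ε₀ → B * s ε ≤ s (ε / 2) := by
    intro ε hε hε'
    have hfin := finite_setOf_le_of_summable hsum (τ := κ * (ε / 2)) (by positivity)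
    have h1 := two_mul_tsum_div_add_sub_le hl hsum hε hκ0 hfin.toFinset (fun i hi => by
      simp only [Set.Finite.mem_toFinset, Set.mem_ofPred_eq, not_le] at hi
      exact hi.le)
    -- The negated claim is applied at scale `a ε / 2`, whose threshold `C a ε / 2` is exactly `κ ε
    -- / 2` because `a = κ / C`.
    have h2 : (hfin.toFinset.card : ℝ) < c * s (a * (ε / 2)) := by
      refine hcon (a * (ε / 2)) (by positivity) ?_ hfin.toFinset (fun i hi => ?_)
      · nlinarith
      · simp only [Set.Finite.mem_toFinset, Set.mem_ofPred_eq] at hi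
        refine le_trans (le_of_eq ?_) hi
        rw [ha]
        field_simp
    have h3 : s (a * (ε / 2)) ≤ a⁻¹ * s (ε / 2) :=
      tsum_div_add_le_mul hl hsum (half_pos hε) ha0 ha1
    have h4 : c * s (a * (ε / 2)) ≤ κ / B * s (ε / 2) := by
      calc c * s (a * (ε / 2)) ≤ c * (a⁻¹ * s (ε / 2)) := by gcongr
        _ = κ / B * s (ε / 2) := by rw [hc]; field_simp
    have h5 : (2 - κ) * s ε ≤ (1 + κ / B) * s (ε / 2) := by
      simp only [hs] at *
      linarith
    have h6 : 2 - κ = B * (1 + κ / B) := by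
      rw [mul_add, mul_div_cancel₀ _ hB0.ne', hκ]
      ring
    rw [h6, mul_right_comm, mul_comm (B * s ε)] at h5
    exact le_of_mul_le_mul_left h5 (by positivity)
  obtain ⟨ε₁, hε₁0, hε₁⟩ := exists_between hε₀
  have hiter : ∀ k : ℕ, B ^ k * s ε₁ ≤ s (ε₁ / 2 ^ k) := by
    intro k
    induction k with
    | zero => simp
    | succ k ih =>
      have hk : (1 : ℝ) ≤ 2 ^ k := one_le_pow₀ (by norm_num)
      have h := hstep (ε₁ / 2 ^ k) (by positivity)
        ((div_le_self hε₁0.le hk).trans_lt hε₁)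
      rw [div_div, ← pow_succ] at h
      refine le_trans ?_ h
      rw [pow_succ, mul_comm (B ^ k), mul_assoc]
      gcongr
  -- Along `ε₁ / 2^k` the sum grows at least like `B^k` but is bounded by a multiple of `(2^p)^k`,
  -- which is absurd for large `k`.
  obtain ⟨M, hM⟩ := hO.bound
  have hlim : Tendsto (fun k : ℕ => ε₁ / 2 ^ k) atTop (𝓝[>] 0) := by
    refine tendsto_nhdsWithin_iff.2 ⟨?_, Eventually.of_forall fun k => ?_⟩
    · exact tendsto_const_nhds.div_atTop (tendsto_pow_atTop_atTop_of_one_lt (by norm_num))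
    · exact Set.mem_Ioi.2 (by positivity)
  have hev := hlim.eventually hM
  have hgrow : Tendsto (fun k : ℕ => (B / 2 ^ p) ^ k) atTop atTop :=
    tendsto_pow_atTop_atTop_of_one_lt ((one_lt_div h2p0).2 hBp)
  obtain ⟨k, hk1, hk2⟩ := (hev.and (hgrow.eventually_gt_atTop (M / ε₁ ^ p / s ε₁))).exists
  rw [div_lt_iff₀ (hspos hε₁0)] at hk2
  rw [Real.norm_of_nonneg (hspos (by positivity)).le, Real.norm_of_nonneg (by positivity),
    Real.div_rpow hε₁0.le (by positivity)] at hk1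
  have h7 := (hiter k).trans hk1
  have h8 : ((2 : ℝ) ^ k) ^ p = (2 ^ p) ^ k := by
    rw [← Real.rpow_natCast, ← Real.rpow_mul (by norm_num), mul_comm,
      Real.rpow_mul (by norm_num), Real.rpow_natCast]
  rw [h8] at h7
  have h9 : M * (1 / (ε₁ ^ p / (2 ^ p) ^ k)) = M / ε₁ ^ p * (2 ^ p) ^ k := by
    field_simp
  rw [h9] at h7
  rw [div_pow, div_mul_eq_mul_div, lt_div_iff₀ (by positivity)] at hk2
  linarith

end EigenvalueCounting

/-! ### Orthogonal projections onto nested subspaces -/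

section StarProjection

variable {E : Type*} [NormedAddCommGroup E] [InnerProductSpace ℝ E] [FiniteDimensional ℝ E]

theorem adjoint_starProjection (N : Submodule ℝ E) :
    ContinuousLinearMap.adjoint N.starProjection = N.starProjection :=
  (ContinuousLinearMap.eq_adjoint_iff _ _).2
    (fun x y => Submodule.inner_starProjection_left_eq_right N x y) |>.symm

theorem norm_sq_starProjection_of_le {N' N : Submodule ℝ E} (h : N' ≤ N) (t : E) :
    ‖N.starProjection t‖ ^ 2
      = ‖(N.starProjection - N'.starProjection) t‖ ^ 2 + ‖N'.starProjection t‖ ^ 2 := by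
  have h1 : N'.starProjection (N.starProjection t) = N'.starProjection t :=
    DFunLike.congr_fun (Submodule.starProjection_comp_starProjection_of_le h) t
  rw [Submodule.norm_sq_eq_add_norm_sq_starProjection (N.starProjection t) N', h1, add_comm,
    Submodule.starProjection_orthogonal', _root_.sub_apply, _root_.sub_apply, h1,
    one_apply_eq_self]

end StarProjection

/-! ### Gaussian vectors: conditioning, small balls, symmetry -/

section GaussianProjection

open ProbabilityTheory

variable {E F : Type*} [NormedAddCommGroup E] [InnerProductSpace ℝ E] [FiniteDimensional ℝ E]
  [MeasurableSpace E] [BorelSpace E] [NormedAddCommGroup F] [InnerProductSpace ℝ F]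
  [FiniteDimensional ℝ F] [MeasurableSpace F] [BorelSpace F]

theorem charFun_map_stdGaussian (L : E →L[ℝ] F) (t : F) :
    charFun ((stdGaussian E).map L) t
      = Complex.exp (-‖ContinuousLinearMap.adjoint L t‖ ^ 2 / 2) := by
  rw [← charFun_stdGaussian, charFun_apply, charFun_apply, integral_map (by fun_prop)
    (Continuous.aestronglyMeasurable (by fun_prop))]
  simp only [ContinuousLinearMap.adjoint_inner_right]

theorem map_orthogonalProjectionOnto_stdGaussian (N : Submodule ℝ E) :
    (stdGaussian E).map N.orthogonalProjectionOnto = stdGaussian N := by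
  have : IsProbabilityMeasure ((stdGaussian E).map N.orthogonalProjectionOnto) :=
    Measure.isProbabilityMeasure_map (by fun_prop)
  refine Measure.ext_of_charFun (funext fun t => ?_)
  rw [charFun_map_stdGaussian, charFun_stdGaussian, Submodule.adjoint_orthogonalProjectionOnto]
  simp

/-- The components in `N'` and in its complement within `N` are independent: by Pythagoras the
exponents of the characteristic functions add. -/
theorem map_starProjection_stdGaussian_eq_conv {N' N : Submodule ℝ E} (h : N' ≤ N) :
    (stdGaussian E).map N.starProjection
      = (stdGaussian E).map ⇑(N.starProjection - N'.starProjection)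
        ∗ (stdGaussian E).map N'.starProjection := by
  have : ∀ L : E →L[ℝ] E, IsProbabilityMeasure ((stdGaussian E).map L) := fun L =>
    Measure.isProbabilityMeasure_map (by fun_prop)
  refine Measure.ext_of_charFun (funext fun t => ?_)
  rw [charFun_conv, charFun_map_stdGaussian, charFun_map_stdGaussian, charFun_map_stdGaussian,
    map_sub, adjoint_starProjection, adjoint_starProjection, ← Complex.exp_add]
  congr 1
  have := norm_sq_starProjection_of_le h t
  have h2 : ((‖N.starProjection t‖ ^ 2 : ℝ) : ℂ)
      = ((‖(N.starProjection - N'.starProjection) t‖ ^ 2 + ‖N'.starProjection t‖ ^ 2 : ℝ) : ℂ) :=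
    congrArg _ this
  simp only [Complex.ofReal_add, Complex.ofReal_pow] at h2
  rw [h2]
  ring

/-- Fubini for Gaussian vectors: a bound for the Gaussian on all translates of a subspace `N'`
gives the same bound for the Gaussian on a larger subspace `N`. -/
theorem stdGaussian_starProjection_le_of_le {N' N : Submodule ℝ E} (h : N' ≤ N) {S : Set E}
    (hS : MeasurableSet S) {δ : ℝ≥0∞}
    (hb : ∀ b ∈ N, stdGaussian E {a | b + N'.starProjection a ∈ S} ≤ δ) :
    stdGaussian E {a | N.starProjection a ∈ S} ≤ δ := by
  have h1 : stdGaussian E {a | N.starProjection a ∈ S}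
      = (stdGaussian E).map N.starProjection S := (Measure.map_apply (by fun_prop) hS).symm
  have : ∀ L : E →L[ℝ] E, IsProbabilityMeasure ((stdGaussian E).map L) := fun L =>
    Measure.isProbabilityMeasure_map (by fun_prop)
  -- Conditioning on the component of `N` orthogonal to `N'`: it plays the part of the translate `b
  -- ∈ N`.
  rw [h1, map_starProjection_stdGaussian_eq_conv h, Measure.conv, Measure.map_apply (by fun_prop) hS,
    Measure.prod_apply (hS.preimage (by fun_prop)),
    lintegral_map (measurable_measure_prodMk_left (hS.preimage (by fun_prop))) (by fun_prop)]
  calc _ ≤ ∫⁻ _ : E, δ ∂(stdGaussian E) := by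
        refine lintegral_mono fun b => ?_
        rw [Measure.map_apply (by fun_prop)
          ((hS.preimage (by fun_prop : Measurable fun q : E × E => q.1 + q.2)).preimage
            (by fun_prop))]
        refine hb _ ?_
        exact N.sub_mem (N.starProjection_apply_mem b) (h (N'.starProjection_apply_mem b))
    _ = δ := by simp

theorem integral_exp_neg_mul_sq_gaussianReal {s : ℝ} :
    ∫ x, Real.exp (-s * x ^ 2) ∂(gaussianReal 0 1) = √(1 / (2 * s + 1)) := by
  rw [integral_gaussianReal_eq_integral_smul one_ne_zero]
  have h : ∀ x, gaussianPDFReal 0 1 x • Real.exp (-s * x ^ 2)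
      = (√(2 * Real.pi))⁻¹ * Real.exp (-(s + 1 / 2) * x ^ 2) := by
    intro x
    simp only [gaussianPDFReal, smul_eq_mul, NNReal.coe_one, mul_one, sub_zero]
    rw [mul_assoc, ← Real.exp_add]
    congr 2
    ring
  simp only [h]
  rw [integral_const_mul, integral_gaussian, ← Real.sqrt_inv, ← Real.sqrt_mul (by positivity)]
  congr 1
  have : 2 * s + 1 = 2 * (s + 1 / 2) := by ring
  rw [this]
  field_simp

theorem integral_exp_neg_mul_norm_sq_stdGaussian {s : ℝ} :
    ∫ x, Real.exp (-s * ‖x‖ ^ 2) ∂(stdGaussian E)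
      = √(1 / (2 * s + 1)) ^ Module.finrank ℝ E := by
  rw [stdGaussian, integral_map (Measurable.aemeasurable (by fun_prop))
    (Continuous.aestronglyMeasurable (by fun_prop))]
  have h : ∀ x : Fin (Module.finrank ℝ E) → ℝ,
      Real.exp (-s * ‖∑ i, x i • stdOrthonormalBasis ℝ E i‖ ^ 2)
        = ∏ i, Real.exp (-s * x i ^ 2) := by
    intro x
    rw [← Real.exp_sum, ← Finset.mul_sum]
    congr 2
    have := (stdOrthonormalBasis ℝ E).orthonormal.inner_sum x x Finset.univ
    rw [real_inner_self_eq_norm_sq] at this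
    rw [this]
    simp [sq]
  simp only [h]
  rw [integral_fintype_prod_eq_pow (f := fun x => Real.exp (-s * x ^ 2)),
    integral_exp_neg_mul_sq_gaussianReal, Fintype.card_fin]

/-- A small ball estimate for the standard Gaussian vector. -/
theorem stdGaussian_norm_sq_le (hE : 0 < Module.finrank ℝ E) :
    (stdGaussian E).real {x | ‖x‖ ^ 2 ≤ Module.finrank ℝ E / 500} ≤ 1 / 10 := by
  set d := Module.finrank ℝ E with hd
  -- Chernoff's bound with exponent `500`: on the ball the integrand is at least `e^{-d}`, its mean
  -- is `1001^{-d/2} ≤ 30^{-d}`, and `e / 30 < 1 / 10`.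
  have hint : Integrable (fun x : E => Real.exp (-500 * ‖x‖ ^ 2)) (stdGaussian E) := by
    refine Integrable.of_bound (Continuous.aestronglyMeasurable (by fun_prop)) 1
      (ae_of_all _ fun x => ?_)
    rw [Real.norm_of_nonneg (Real.exp_pos _).le, Real.exp_le_one_iff]
    nlinarith [sq_nonneg ‖x‖]
  have h1 := mul_meas_ge_le_integral_of_nonneg (ae_of_all _ fun x => (Real.exp_pos _).le) hint
    (Real.exp (-d))
  rw [integral_exp_neg_mul_norm_sq_stdGaussian] at h1
  have h2 : {x : E | ‖x‖ ^ 2 ≤ d / 500}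
      ⊆ {x : E | Real.exp (-d) ≤ Real.exp (-500 * ‖x‖ ^ 2)} := by
    intro x hx
    simp only [Set.mem_ofPred_eq, Real.exp_le_exp] at hx ⊢
    linarith
  have h3 : √(1 / (2 * 500 + 1)) ≤ 1 / 30 := by
    rw [Real.sqrt_le_left (by norm_num)]
    norm_num
  have h4 : (stdGaussian E).real {x : E | Real.exp (-d) ≤ Real.exp (-500 * ‖x‖ ^ 2)}
      ≤ Real.exp d * √(1 / (2 * 500 + 1)) ^ d := by
    refine (inv_mul_le_iff₀ (Real.exp_pos _)).1 ?_
    rwa [← Real.exp_neg]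
  have he : Real.exp d = Real.exp 1 ^ d := by rw [← Real.exp_nat_mul, mul_one]
  calc _ ≤ _ := measureReal_mono h2
    _ ≤ _ := h4
    _ ≤ Real.exp 1 ^ d * (1 / 30) ^ d := by rw [he]; gcongr
    _ = (Real.exp 1 / 30) ^ d := by rw [← mul_pow, mul_one_div]
    _ ≤ (1 / 10) ^ d := by
        have := Real.exp_one_lt_d9
        exact pow_le_pow_left₀ (by positivity) (by linarith) d
    _ ≤ (1 / 10) ^ 1 := pow_le_pow_of_le_one (by norm_num) (by norm_num) hE
    _ = 1 / 10 := by norm_num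

theorem stdGaussian_norm_sq_starProjection_le {N : Submodule ℝ E} (hN : 0 < Module.finrank ℝ N) :
    (stdGaussian E).real {x | ‖N.starProjection x‖ ^ 2 ≤ Module.finrank ℝ N / 500} ≤ 1 / 10 := by
  have h := stdGaussian_norm_sq_le hN
  rw [← map_orthogonalProjectionOnto_stdGaussian, map_measureReal_apply (by fun_prop)
    (measurableSet_le (by fun_prop) (by fun_prop))] at h
  exact h

theorem integral_norm_sq_stdGaussian :
    ∫ x, ‖x‖ ^ 2 ∂(stdGaussian E) = Module.finrank ℝ E := by
  have h1 : ∀ x : E, ‖x‖ ^ 2 = ∑ i, (innerSL ℝ (stdOrthonormalBasis ℝ E i) x) ^ 2 := by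
    intro x
    rw [← (stdOrthonormalBasis ℝ E).sum_sq_inner_right]
    simp
  have hmem : ∀ i, MemLp (fun x => innerSL ℝ (stdOrthonormalBasis ℝ E i) x) 2 (stdGaussian E) :=
    fun i => (innerSL ℝ (stdOrthonormalBasis ℝ E i)).comp_memLp'
      (IsGaussian.memLp_id (stdGaussian E) 2 (by norm_num))
  have h2 : ∀ i, ∫ x, (innerSL ℝ (stdOrthonormalBasis ℝ E i) x) ^ 2 ∂(stdGaussian E) = 1 := by
    intro i
    have h := variance_dual_stdGaussian (innerSL ℝ (stdOrthonormalBasis ℝ E i))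
    rw [variance_eq_sub (hmem i), integral_strongDual_stdGaussian, innerSL_apply_norm,
      (stdOrthonormalBasis ℝ E).orthonormal.1 i] at h
    simpa using h
  simp only [h1]
  rw [integral_finsetSum _ fun i _ => (hmem i).integrable_sq]
  simp only [h2]
  simp

/-- Markov's inequality, the mean of `‖x‖²` being the dimension. -/
theorem stdGaussian_norm_sq_ge (hE : 0 < Module.finrank ℝ E) :
    (stdGaussian E).real {x | 12 * Module.finrank ℝ E ≤ ‖x‖ ^ 2} ≤ 1 / 12 := by
  have hint : Integrable (fun x : E => ‖x‖ ^ 2) (stdGaussian E) :=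
    (IsGaussian.memLp_id (stdGaussian E) 2 (by norm_num)).integrable_norm_pow (by norm_num)
  have h := mul_meas_ge_le_integral_of_nonneg (ae_of_all _ fun x => by positivity) hint
    (12 * Module.finrank ℝ E)
  rw [integral_norm_sq_stdGaussian] at h
  have hE' : (0 : ℝ) < Module.finrank ℝ E := by exact_mod_cast hE
  rw [mul_comm (12 : ℝ), mul_assoc] at h
  have h5 := (mul_le_iff_le_one_right hE').1 h
  rw [mul_comm (Module.finrank ℝ E : ℝ)] at h5
  linarith

theorem stdGaussian_preimage_neg (S : Set E) (hS : MeasurableSet S) :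
    stdGaussian E (-S) = stdGaussian E S := by
  conv_rhs => rw [← stdGaussian_map (LinearIsometryEquiv.neg ℝ (E := E)),
    Measure.map_apply (by fun_prop) hS]
  rfl

/-- A set that meets its reflection in a set of small Gaussian measure has measure at most
about one half. -/
theorem two_mul_stdGaussian_real_le {S : Set E} (hS : MeasurableSet S) :
    2 * (stdGaussian E).real S ≤ 1 + (stdGaussian E).real (S ∩ -S) := by
  have h := measureReal_union_add_inter (μ := stdGaussian E) (s := S) hS.neg
  have h2 : (stdGaussian E).real (-S) = (stdGaussian E).real S := by
    rw [measureReal_def, stdGaussian_preimage_neg S hS, measureReal_def]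
  have h3 : (stdGaussian E).real (S ∪ -S) ≤ 1 := measureReal_le_one
  linarith

end GaussianProjection

/-! ### Finite-dimensional families of signals -/

section Synthesis

variable {m : ℕ} (φ : Fin m → ℝ → ℂ)

/-- The value at `t` of the real linear combination of the functions `φ j` with coefficients `a`,
as a linear map in `a`. -/
noncomputable def synthesis (t : ℝ) : EuclideanSpace ℝ (Fin m) →ₗ[ℝ] ℂ where
  toFun a := ∑ j, (a j : ℂ) * φ j t
  map_add' a b := by
    simp [add_mul, Finset.sum_add_distrib]
  map_smul' c a := by
    simp [Finset.mul_sum, mul_assoc]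

variable {φ}

theorem continuous_synthesis (hφ : ∀ j, Continuous (φ j)) :
    Continuous fun q : EuclideanSpace ℝ (Fin m) × ℝ => synthesis φ q.2 q.1 := by
  change Continuous fun q : EuclideanSpace ℝ (Fin m) × ℝ => ∑ j, (q.1 j : ℂ) * φ j q.2
  fun_prop

theorem measurable_synthesis (hφ : ∀ j, Continuous (φ j)) :
    Measurable fun q : EuclideanSpace ℝ (Fin m) × ℝ => (fun a t => synthesis φ t a) q.1 q.2 :=
  (continuous_synthesis hφ).measurable

/-- One complex answer amounts to two real linear conditions. -/
theorem finrank_le_finrank_inf_ker_add_two {E : Type*} [AddCommGroup E] [Module ℝ E]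
    [FiniteDimensional ℝ E] (N : Submodule ℝ E) (L : E →ₗ[ℝ] ℂ) :
    Module.finrank ℝ N ≤ Module.finrank ℝ ↥(N ⊓ LinearMap.ker L) + 2 := by
  have h1 := Submodule.finrank_sup_add_finrank_inf_eq N (LinearMap.ker L)
  have h2 := L.finrank_range_add_finrank_ker
  have h3 : Module.finrank ℝ (LinearMap.range L) ≤ 2 :=
    (Submodule.finrank_le _).trans_eq Complex.finrank_real_complex
  have h4 := Submodule.finrank_le (N ⊔ LinearMap.ker L)
  omega

end Synthesis

/-! ### Estimates and measurability for the energy -/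

section Energy

theorem energy_sub_le {ν : Measure ℝ} {f g : ℝ → ℂ} (hf : Measurable f) :
    energy ν (fun t => f t - g t) ≤ 2 * (energy ν f + energy ν g) := by
  unfold energy
  rw [← lintegral_add_left (by fun_prop), ← lintegral_const_mul' _ _ (by norm_num)]
  refine lintegral_mono fun t => ?_
  refine (pow_le_pow_left₀ (zero_le) (enorm_sub_le (a := f t) (b := g t)) 2).trans ?_
  have := ENNReal.rpow_add_le_mul_rpow_add_rpow ‖f t‖ₑ ‖g t‖ₑ (p := 2) (by norm_num)
  norm_num at this
  exact this

theorem measurable_energy {X : Type*} [MeasurableSpace X] {ν : Measure ℝ} [SFinite ν]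
    {f : X × ℝ → ℂ} (hf : Measurable f) : Measurable fun x => energy ν fun t => f (x, t) :=
  (hf.enorm.pow_const 2).lintegral_prod_right'

end Energy

/-! ### Adaptive algorithms on Gaussian signals -/

namespace QueryAlgorithm

open ProbabilityTheory

variable {T : ℝ} (A : QueryAlgorithm.{u} T)

theorem answers_succ (f : ℝ → ℂ) (ω : A.Seed) (k : ℕ) :
    A.answers f ω (k + 1) = Fin.snoc (A.answers f ω k) (f (A.query k (ω, A.answers f ω k))) := rfl

/-- Joint measurability in seed and signal is what later permits exchanging the average over seeds
with the Gaussian average. -/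
theorem measurable_answers {X : Type*} [MeasurableSpace X] {Y : X → ℝ → ℂ}
    (hY : Measurable fun q : X × ℝ => Y q.1 q.2) (k : ℕ) :
    Measurable fun q : A.Seed × X => A.answers (Y q.2) q.1 k := by
  induction k with
  | zero => exact measurable_pi_iff.2 fun i => i.elim0
  | succ k ih =>
    refine measurable_pi_iff.2 fun i => ?_
    refine Fin.lastCases ?_ (fun i => ?_) i
    · simp only [answers_succ, Fin.snoc_last]
      exact hY.comp (measurable_snd.prodMk
        ((A.measurable_query k).comp (measurable_fst.prodMk ih)))
    · simp only [answers_succ, Fin.snoc_castSucc]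
      exact (measurable_pi_apply i).comp ih

theorem measurableSet_haltsAfter {X : Type*} [MeasurableSpace X] {Y : X → ℝ → ℂ}
    (hY : Measurable fun q : X × ℝ => Y q.1 q.2) (k : ℕ) :
    MeasurableSet {q : A.Seed × X | A.HaltsAfter (Y q.2) q.1 k} := by
  have h : ∀ j, MeasurableSet {q : A.Seed × X | (q.1, A.answers (Y q.2) q.1 j) ∈ A.halt j} :=
    fun j => (A.measurableSet_halt j).preimage (measurable_fst.prodMk (A.measurable_answers hY j))
  have h2 : {q : A.Seed × X | A.HaltsAfter (Y q.2) q.1 k}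
      = {q : A.Seed × X | (q.1, A.answers (Y q.2) q.1 k) ∈ A.halt k}
        ∩ ⋂ j, ⋂ (_ : j < k), {q : A.Seed × X | (q.1, A.answers (Y q.2) q.1 j) ∈ A.halt j}ᶜ := by
    ext q
    simp [HaltsAfter]
  rw [h2]
  exact (h k).inter (MeasurableSet.iInter fun j => MeasurableSet.iInter fun _ => (h j).compl)

theorem measurableSet_achieves {X : Type*} [MeasurableSpace X] {Y : X → ℝ → ℂ}
    (hY : Measurable fun q : X × ℝ => Y q.1 q.2) {B : X → ℝ≥0∞} (hB : Measurable B) :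
    MeasurableSet {q : A.Seed × X | A.Achieves (Y q.2) (Y q.2) (B q.2) q.1} := by
  have h : {q : A.Seed × X | A.Achieves (Y q.2) (Y q.2) (B q.2) q.1}
      = ⋃ k, {q : A.Seed × X | A.HaltsAfter (Y q.2) q.1 k} ∩ {q : A.Seed × X |
        energy (uniformTime T) (fun t => Y q.2 t - A.output k (q.1, A.answers (Y q.2) q.1 k) t)
          ≤ B q.2} := by
    ext q
    simp [Achieves]
  rw [h]
  refine MeasurableSet.iUnion fun k => (A.measurableSet_haltsAfter hY k).inter
    (measurableSet_le ?_ (hB.comp measurable_snd))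
  refine measurable_energy (f := fun q : (A.Seed × X) × ℝ =>
    Y q.1.2 q.2 - A.output k (q.1.1, A.answers (Y q.1.2) q.1.1 k) q.2) (Measurable.sub ?_ ?_)
  · exact hY.comp ((measurable_snd.comp measurable_fst).prodMk measurable_snd)
  · exact (A.measurable_output k).comp
      (((measurable_fst.comp measurable_fst).prodMk
        ((A.measurable_answers hY k).comp measurable_fst)).prodMk measurable_snd)

theorem HaltsAfter.unique {A : QueryAlgorithm.{u} T} {f : ℝ → ℂ} {ω : A.Seed} {j k : ℕ}
    (hj : A.HaltsAfter f ω j) (hk : A.HaltsAfter f ω k) : j = k := by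
  rcases lt_trichotomy j k with h | h | h
  · exact (hk.2 j h hj.1).elim
  · exact h
  · exact (hj.2 k h hk.1).elim

theorem Achieves.mono {A : QueryAlgorithm.{u} T} {f y : ℝ → ℂ} {ω : A.Seed} {B B' : ℝ≥0∞}
    (h : A.Achieves f y B ω) (hB : B ≤ B') : A.Achieves f y B' ω :=
  let ⟨k, hk, he⟩ := h
  ⟨k, hk, he.trans hB⟩

variable {m : ℕ} {φ : Fin m → ℝ → ℂ}

/-- A fixed output function is close to a random signal from a high-dimensional affine family
with probability at most `11 / 20`. -/
theorem stdGaussian_energy_sub_le (hφ : ∀ j, Continuous (φ j)) {τ B : ℝ} (hτ : 0 < τ)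
    (hY : ∀ a, ENNReal.ofReal (τ * ‖a‖ ^ 2) ≤ energy (uniformTime T) (fun t => synthesis φ t a))
    {N : Submodule ℝ (EuclideanSpace ℝ (Fin m))} (hN : 0 < Module.finrank ℝ N)
    (hB0 : 0 ≤ B) (hB : B / τ ≤ Module.finrank ℝ N / 500) {g : ℝ → ℂ} (hg : Measurable g)
    (c : EuclideanSpace ℝ (Fin m)) :
    (stdGaussian (EuclideanSpace ℝ (Fin m))).real
      {a | energy (uniformTime T) (fun t => synthesis φ t (c + N.starProjection a) - g t)
        ≤ ENNReal.ofReal B} ≤ 11 / 20 := by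
  set U := {a | energy (uniformTime T) (fun t => synthesis φ t (c + N.starProjection a) - g t)
    ≤ ENNReal.ofReal B} with hU
  have hYm := measurable_synthesis hφ
  have hUm : MeasurableSet U := by
    have h : Continuous fun q : EuclideanSpace ℝ (Fin m) × ℝ =>
        synthesis φ q.2 (c + N.starProjection q.1) :=
      (continuous_synthesis hφ).comp (g := fun q : EuclideanSpace ℝ (Fin m) × ℝ =>
        synthesis φ q.2 q.1) (Continuous.prodMk (by fun_prop) continuous_snd)
    have h' : Measurable fun q : EuclideanSpace ℝ (Fin m) × ℝ =>
        synthesis φ q.2 (c + N.starProjection q.1) - g q.2 :=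
      h.measurable.sub (hg.comp measurable_snd)
    have h'' := measurable_energy (ν := uniformTime T) h'
    have h3 : Measurable fun a => energy (uniformTime T)
        (fun t => synthesis φ t (c + N.starProjection a) - g t) := h''
    exact measurableSet_le h3 measurable_const
  have h1 := two_mul_stdGaussian_real_le hUm
  -- If `g` is close to the signals of both `c + n` and `c - n`, their difference, the signal of `2
  -- n`, has energy at most `4 B`; hence `τ ‖n‖² ≤ B`, an event of probability at most `1 / 10`.
  have h2 : U ∩ -U ⊆ {a | ‖N.starProjection a‖ ^ 2 ≤ Module.finrank ℝ N / 500} := by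
    rintro a ⟨ha, ha'⟩
    rw [Set.mem_neg] at ha'
    simp only [hU, Set.mem_ofPred_eq] at ha ha' ⊢
    set n := N.starProjection a with hn
    rw [map_neg, ← hn] at ha'
    have h3 := energy_sub_le (ν := uniformTime T)
      (f := fun t => synthesis φ t (c + n) - g t) (g := fun t => synthesis φ t (c + -n) - g t)
      ((hYm.comp (measurable_const.prodMk measurable_id)).sub hg)
    have h4 : (fun t => synthesis φ t (c + n) - g t - (synthesis φ t (c + -n) - g t))
        = fun t => synthesis φ t ((2 : ℝ) • n) := by
      funext t
      rw [map_add, map_add, map_neg, map_smul, two_smul]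
      ring
    rw [h4] at h3
    have h5 : ENNReal.ofReal (τ * ‖(2 : ℝ) • n‖ ^ 2) ≤ ENNReal.ofReal (4 * B) :=
      calc _ ≤ _ := hY _
        _ ≤ _ := h3
        _ ≤ 2 * (ENNReal.ofReal B + ENNReal.ofReal B) := by gcongr
        _ = ENNReal.ofReal (4 * B) := by
          rw [← ENNReal.ofReal_add hB0 hB0, ← ENNReal.ofReal_ofNat 2,
            ← ENNReal.ofReal_mul (by norm_num)]
          congr 1
          ring
    rw [ENNReal.ofReal_le_ofReal_iff (by positivity), norm_smul, mul_pow] at h5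
    norm_num at h5
    refine le_trans ((le_div_iff₀ hτ).2 ?_) hB
    linarith
  have h6 := (measureReal_mono h2).trans (stdGaussian_norm_sq_starProjection_le hN)
  linarith

/-- A deterministic adaptive algorithm with few queries recovers a random signal from a
high-dimensional family with probability at most `11 / 20`. -/
theorem stdGaussian_achieves_le (hφ : ∀ j, Continuous (φ j)) {τ B : ℝ} (hτ : 0 < τ)
    (hY : ∀ a, ENNReal.ofReal (τ * ‖a‖ ^ 2) ≤ energy (uniformTime T) (fun t => synthesis φ t a))
    (hB0 : 0 ≤ B) {r : ℕ} (hr : 4 * r < m) (hB : B / τ ≤ m / 1000) (ω : A.Seed)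
    (hmost : ∀ a, ∃ k ≤ r, A.HaltsAfter (fun t => synthesis φ t a) ω k) :
    stdGaussian (EuclideanSpace ℝ (Fin m)) {a | A.Achieves (fun t => synthesis φ t a)
      (fun t => synthesis φ t a) (ENNReal.ofReal B) ω} ≤ ENNReal.ofReal (11 / 20) := by
  set S := {a | A.Achieves (fun t => synthesis φ t a)
      (fun t => synthesis φ t a) (ENNReal.ofReal B) ω} with hS
  have hYm := measurable_synthesis hφ
  have hSm : MeasurableSet S :=
    (A.measurableSet_achieves (Y := fun a t => synthesis φ t a) hYm (B := fun _ => ENNReal.ofReal B) measurable_const).preimage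
      measurable_prodMk_left
  -- after `j` queries, the signals consistent with the answers form an affine space `c + N`
  have key : ∀ n j : ℕ, j + n = r → ∀ (N : Submodule ℝ (EuclideanSpace ℝ (Fin m)))
      (c : EuclideanSpace ℝ (Fin m)) (ans : Fin j → ℂ), m ≤ Module.finrank ℝ N + 2 * j →
      (∀ a ∈ N, A.answers (fun t => synthesis φ t (c + a)) ω j = ans) →
      (∀ a ∈ N, ∀ i < j, (ω, A.answers (fun t => synthesis φ t (c + a)) ω i) ∉ A.halt i) →
      stdGaussian (EuclideanSpace ℝ (Fin m)) {a | c + N.starProjection a ∈ S}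
        ≤ ENNReal.ofReal (11 / 20) := by
    -- Induction on the number `n` of queries still allowed; both cases share the situation where
    -- the algorithm halts now.
    intro n
    induction n with
    | zero => ?_
    | succ n ih => ?_
    all_goals
      intro j hj N c ans hdim hans hhalt
      by_cases hhalted : (ω, ans) ∈ A.halt j
      -- A leaf: every signal in `c + N` gets the same output, and `dim N ≥ m - 2 j ≥ m / 2` because
      -- `j ≤ r` and `4 r < m`.
      · have hd : m ≤ 2 * Module.finrank ℝ N := by omega
        have hd' : (m : ℝ) ≤ 2 * Module.finrank ℝ N := by exact_mod_cast hd
        have hleaf := stdGaussian_energy_sub_le hφ hτ hY (N := N) (by omega) hB0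
          (hB.trans (by linarith)) (g := A.output j (ω, ans))
          ((A.measurable_output j).comp measurable_prodMk_left) c
        rw [measureReal_def] at hleaf
        have hleaf' := (ENNReal.le_ofReal_iff_toReal_le (measure_ne_top _ _) (by norm_num)).2 hleaf
        refine le_trans (measure_mono ?_) hleaf'
        rintro a ⟨k, hk, he⟩
        have hj' : A.HaltsAfter (fun t => synthesis φ t (c + N.starProjection a)) ω j :=
          ⟨by rw [hans _ (N.starProjection_apply_mem a)]; exact hhalted,
            hhalt _ (N.starProjection_apply_mem a)⟩
        obtain rfl := hj'.unique hk
        rw [hans _ (N.starProjection_apply_mem a)] at he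
        exact he
      have hnohalt : ∀ a ∈ N, ∀ i < j + 1,
          (ω, A.answers (fun t => synthesis φ t (c + a)) ω i) ∉ A.halt i := by
        intro a ha i hi
        rcases Nat.lt_succ_iff_lt_or_eq.1 hi with h | rfl
        · exact hhalt a ha i h
        · rwa [hans a ha]
    -- With no query left, failing to halt contradicts the query bound at the centre of the family.
    · obtain ⟨k, hk, hk'⟩ := hmost (c + 0)
      exact (hnohalt 0 N.zero_mem k (by omega) hk'.1).elim
    · set t₀ := A.query j (ω, ans) with ht₀
      -- With the translate `b` fixed, the next answer is constant on `c + b + (N ⊓ ker)`, so the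
      -- induction hypothesis applies to this smaller family.
      refine stdGaussian_starProjection_le_of_le
        (inf_le_left : N ⊓ LinearMap.ker (synthesis φ t₀) ≤ N)
        (hSm.preimage (measurable_const_add c)) (fun b hb => ?_)
      have hmem : ∀ a ∈ N ⊓ LinearMap.ker (synthesis φ t₀), b + a ∈ N :=
        fun a ha => N.add_mem hb ha.1
      have h := ih (j + 1) (by omega) (N ⊓ LinearMap.ker (synthesis φ t₀)) (c + b)
        (Fin.snoc ans (synthesis φ t₀ (c + b)))
        (by have := finrank_le_finrank_inf_ker_add_two N (synthesis φ t₀); omega)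
        (fun a ha => by
          rw [answers_succ, add_assoc, hans _ (hmem a ha), ← ht₀, ← add_assoc,
            map_add _ (c + b) a, LinearMap.mem_ker.1 ha.2, add_zero])
        (fun a ha i hi => by
          rw [add_assoc]
          exact hnohalt _ (hmem a ha) i hi)
      simpa only [Set.mem_preimage, ← add_assoc] using h
  have h := key r 0 (by simp) ⊤ 0 Fin.elim0 (by simp) (fun a _ => rfl) (by simp)
  have htop : ∀ a, (⊤ : Submodule ℝ (EuclideanSpace ℝ (Fin m))).starProjection a = a :=
    fun a => Submodule.starProjection_eq_self_iff.2 Submodule.mem_top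
  simpa only [htop, zero_add, Set.ofPred_mem_eq] using h

/-- An algorithm that recovers all signals from an `m`-dimensional family needs at least `m / 4`
queries. -/
theorem card_le_four_mul_queries (hφ : ∀ j, Continuous (φ j)) {ε : ℝ} (hε : 0 < ε)
    (hY : ∀ a, ENNReal.ofReal (12000 * ε * ‖a‖ ^ 2)
      ≤ energy (uniformTime T) (fun t => synthesis φ t a)) {r : ℕ}
    (hsolve : ∀ a, 2 / 3 ≤ A.law {ω | A.Achieves (fun t => synthesis φ t a)
      (fun t => synthesis φ t a) (ENNReal.ofReal (ε * ‖a‖ ^ 2)) ω})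
    (hmost : ∀ a ω, ∃ k ≤ r, A.HaltsAfter (fun t => synthesis φ t a) ω k) : m ≤ 4 * r := by
  by_contra! hr
  set γ := stdGaussian (EuclideanSpace ℝ (Fin m)) with hγ
  have hYm := measurable_synthesis hφ
  have hDm := A.measurableSet_achieves (Y := fun a t => synthesis φ t a) hYm
    (B := fun a : EuclideanSpace ℝ (Fin m) => ENNReal.ofReal (ε * ‖a‖ ^ 2)) (by fun_prop)
  set D := {q : A.Seed × EuclideanSpace ℝ (Fin m) | A.Achieves (fun t => synthesis φ t q.2)
    (fun t => synthesis φ t q.2) (ENNReal.ofReal (ε * ‖q.2‖ ^ 2)) q.1} with hD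
  have hlow : 2 / 3 ≤ (A.law.prod γ) D := by
    rw [Measure.prod_apply_symm hDm]
    calc (2 / 3 : ℝ≥0∞) = ∫⁻ _, 2 / 3 ∂γ := by simp
      _ ≤ _ := lintegral_mono fun a => hsolve a
  have hfin : Module.finrank ℝ (EuclideanSpace ℝ (Fin m)) = m := by simp
  have hslice : ∀ ω, γ (Prod.mk ω ⁻¹' D) ≤ ENNReal.ofReal (11 / 20) + ENNReal.ofReal (1 / 12) := by
    intro ω
    -- With `B = 12 ε m` and `τ = 12000 ε` the ratio is exactly `m / 1000`. Where `‖a‖² ≤ 12 m`, the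
    -- permitted error `ε ‖a‖²` is at most `B`; the rest has probability at most `1 / 12`.
    have h1 := A.stdGaussian_achieves_le hφ (τ := 12000 * ε) (B := 12 * ε * m) (by positivity) hY
      (by positivity) hr (le_of_eq (by field_simp; ring)) ω (fun a => hmost a ω)
    have h2 := stdGaussian_norm_sq_ge (E := EuclideanSpace ℝ (Fin m)) (by omega)
    rw [measureReal_def] at h2
    have h2' := (ENNReal.le_ofReal_iff_toReal_le (measure_ne_top _ _) (by norm_num)).2 h2
    refine le_trans ((measure_mono ?_).trans (measure_union_le _ _)) (add_le_add h1 h2')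
    intro a ha
    rw [hfin]
    rcases le_total (12 * (m : ℝ)) (‖a‖ ^ 2) with h | h
    · exact Or.inr h
    · refine Or.inl (Achieves.mono (show A.Achieves _ _ _ ω from ha) (ENNReal.ofReal_le_ofReal ?_))
      nlinarith
  have hup : (A.law.prod γ) D ≤ ENNReal.ofReal (11 / 20) + ENNReal.ofReal (1 / 12) := by
    rw [Measure.prod_apply hDm]
    calc _ ≤ ∫⁻ _, (ENNReal.ofReal (11 / 20) + ENNReal.ofReal (1 / 12)) ∂A.law :=
          lintegral_mono hslice
      _ = _ := by simp
  -- The contradiction is `11/20 + 1/12 = 19/30 < 2/3`.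
  have h := hlow.trans hup
  rw [← ENNReal.ofReal_add (by norm_num) (by norm_num),
    show (2 / 3 : ℝ≥0∞) = ENNReal.ofReal (2 / 3) by
      rw [ENNReal.ofReal_div_of_pos (by norm_num)]; simp,
    ENNReal.ofReal_le_ofReal_iff (by norm_num)] at h
  norm_num at h

end QueryAlgorithm

/-! ### From large eigenvalues to query lower bounds -/

section LowerBound

theorem energy_coeFn {ν : Measure ℝ} (z : Lp ℂ 2 ν) : energy ν z = ENNReal.ofReal (‖z‖ ^ 2) := by
  rw [norm_sq_eq_integral, ofReal_integral_eq_lintegral_ofReal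
    ((Lp.memLp z).integrable_norm_pow (by norm_num)) (ae_of_all _ fun _ => by positivity)]
  refine lintegral_congr fun t => ?_
  rw [ENNReal.ofReal_pow (norm_nonneg _), ofReal_norm]

theorem energy_congr_ae {ν : Measure ℝ} {f g : ℝ → ℂ} (h : f =ᵐ[ν] g) :
    energy ν f = energy ν g := by
  refine lintegral_congr_ae ?_
  filter_upwards [h] with t ht
  rw [ht]

/-- Holds at every `t`, not merely almost everywhere, so the signal depends linearly on `x` at each
single query point. -/
theorem invFourier_eq_inner (μ : Measure ℝ) [IsFiniteMeasure μ] (t : ℝ) (x : Lp ℂ 2 μ) :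
    invFourier μ x t = inner ℂ ((memLp_character μ (-t)).toLp _) x := by
  rw [← expTransform_neg_one_eq_inner, invFourier, expTransform, expTransform]
  simp

theorem norm_sq_sum_smul_orthonormal {H : Type*} [NormedAddCommGroup H] [InnerProductSpace ℂ H]
    {m : ℕ} {v : Fin m → H} (hv : Orthonormal ℂ v) (b : Fin m → ℝ) :
    ‖∑ j, (b j : ℂ) • v j‖ ^ 2 = ∑ j, b j ^ 2 := by
  have h := hv.inner_sum (fun j => (b j : ℂ)) (fun j => (b j : ℂ)) Finset.univ
  rw [inner_self_eq_norm_sq_to_K] at h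
  apply Complex.ofReal_injective
  simp only [Complex.conj_ofReal] at h
  push_cast
  simpa [sq] using h

variable {μ : Measure ℝ} [IsProbabilityMeasure μ] {T : ℝ}

/-- The number of queries is at least a quarter of the number of eigenvalues above `12000 ε`. -/
theorem card_eigenvalues_le {ι : Type*} {v : ι → Lp ℂ 2 (uniformTime T)} (hv : Orthonormal ℂ v)
    {l : ι → ℝ} (hK : ∀ i, kernelOp μ T (v i) = (l i : ℂ) • v i) {C ε : ℝ} (hε : 0 < ε)
    (F : Finset ι) (hF : ∀ i ∈ F, 12000 * ε ≤ l i) (A : QueryAlgorithm.{u} T) {r : ℕ}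
    (hsolve : A.Solves μ C ε) (hmost : A.MakesAtMost μ r) : F.card ≤ 4 * r := by
  set e : Fin F.card → ι := fun j => (F.equivFin.symm j : ι) with he
  have hinj : Function.Injective e := fun i j h => F.equivFin.symm.injective (Subtype.ext h)
  have hle : ∀ j, 12000 * ε ≤ l (e j) := fun j => hF _ (F.equivFin.symm j).2
  have hpos : ∀ j, 0 < l (e j) := fun j => lt_of_lt_of_le (by positivity) (hle j)
  have hsqrt : ∀ j, 0 < √(l (e j)) := fun j => Real.sqrt_pos.2 (hpos j)
  have hve : Orthonormal ℂ (v ∘ e) := hv.comp e hinj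
  -- Left singular vectors of `F`: the factor `λ^{-1/2}` makes them orthonormal, with signals `√λ
  -- v`.
  set x : Fin F.card → Lp ℂ 2 μ := fun j =>
    ((√(l (e j)))⁻¹ : ℂ) • expOp (uniformTime T) μ (-1) (v (e j)) with hx
  have hGx : ∀ j, expOp μ (uniformTime T) 1 (x j) = ((√(l (e j)) : ℝ) : ℂ) • v (e j) := by
    intro j
    rw [hx, map_smul, ← kernelOp_apply, hK, smul_smul]
    congr 1
    rw [← Complex.ofReal_inv, ← Complex.ofReal_mul, inv_mul_eq_div, Real.div_sqrt]
  have hxon : Orthonormal ℂ x := by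
    classical
    rw [orthonormal_iff_ite]
    intro i j
    have h := orthonormal_iff_ite.1 hve i j
    rw [hx]
    simp only
    rw [inner_smul_left, inner_expOp_left]
    have h2 := hGx j
    rw [hx] at h2
    simp only at h2
    rw [h2, inner_smul_right]
    simp only [Function.comp_apply] at h
    rw [h]
    split_ifs with hij
    · subst hij
      rw [mul_one, ← Complex.ofReal_inv, Complex.conj_ofReal, ← Complex.ofReal_mul,
        inv_mul_cancel₀ (hsqrt i).ne', Complex.ofReal_one]
    · simp
  set φ : Fin F.card → ℝ → ℂ := fun j => invFourier μ (x j) with hφdef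
  have hφ : ∀ j, Continuous (φ j) := fun j =>
    continuous_expTransform 1 ((Lp.memLp (x j)).integrable one_le_two)
  set X : EuclideanSpace ℝ (Fin F.card) → Lp ℂ 2 μ := fun a => ∑ j, ((a j : ℝ) : ℂ) • x j with hX
  have hsyn : ∀ a, invFourier μ (X a) = fun t => synthesis φ t a := by
    intro a
    funext t
    rw [invFourier_eq_inner, hX, inner_sum]
    change _ = ∑ j, (a j : ℂ) * φ j t
    refine Finset.sum_congr rfl fun j _ => ?_
    rw [inner_smul_right, hφdef]
    simp only
    rw [invFourier_eq_inner]
  have hXen : ∀ a, energy μ (X a) = ENNReal.ofReal (‖a‖ ^ 2) := by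
    intro a
    rw [energy_coeFn, hX, norm_sq_sum_smul_orthonormal hxon, EuclideanSpace.real_norm_sq_eq]
  have hY : ∀ a, ENNReal.ofReal (12000 * ε * ‖a‖ ^ 2)
      ≤ energy (uniformTime T) (fun t => synthesis φ t a) := by
    intro a
    have h1 : expOp μ (uniformTime T) 1 (X a)
        = ∑ j, ((a j * √(l (e j)) : ℝ) : ℂ) • (v ∘ e) j := by
      rw [hX, map_sum]
      refine Finset.sum_congr rfl fun j _ => ?_
      rw [map_smul, hGx, smul_smul, Complex.ofReal_mul]
      rfl
    rw [← hsyn, invFourier, ← energy_congr_ae (coeFn_expOp μ (uniformTime T) 1 (X a)), energy_coeFn, h1,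
      norm_sq_sum_smul_orthonormal hve, EuclideanSpace.real_norm_sq_eq, Finset.mul_sum]
    refine ENNReal.ofReal_le_ofReal (Finset.sum_le_sum fun j _ => ?_)
    rw [mul_pow, Real.sq_sqrt (hpos j).le, mul_comm]
    exact mul_le_mul_of_nonneg_left (hle j) (sq_nonneg _)
  refine A.card_le_four_mul_queries hφ hε hY (fun a => ?_) (fun a => ?_)
  -- The noise is zero, so the term with `C` vanishes and the bound is independent of `C`.
  · have h := hsolve (X a) (fun _ => 0) (Lp.memLp _) measurable_const (memLp_const 0)
    rw [hXen, hsyn, ← ENNReal.ofReal_mul hε.le] at h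
    simpa [energy] using h
  · have h := hmost (X a) (fun _ => 0) (Lp.memLp _) measurable_const (memLp_const 0)
    rw [hsyn] at h
    simpa using h

/-- At arbitrarily small scales, the statistical dimension is a lower bound for the number of
queries, up to a constant. -/
theorem exists_const_mul_statDim_le (hT : 0 < T) {p : ℝ} (hp : p < 1)
    (hs : (fun ε : ℝ => statDim μ T ε) =O[𝓝[>] 0] (fun ε : ℝ => 1 / ε ^ p)) :
    ∃ c : ℝ, 0 < c ∧ ∀ ε₀ : ℝ, 0 < ε₀ → ∃ ε : ℝ, 0 < ε ∧ ε < ε₀ ∧ 0 < statDim μ T ε ∧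
      ∀ C : ℝ, ∀ (A : QueryAlgorithm.{u} T) (r : ℕ),
        A.Solves μ C ε → A.MakesAtMost μ r → c * statDim μ T ε ≤ (r : ℝ) := by
  obtain ⟨ι, v, l, hK, hl, hsum, hpos, hdim⟩ := exists_eigenbasis_kernelOp μ hT
  have hO : (fun ε : ℝ => ∑' i, l i / (l i + ε)) =O[𝓝[>] 0] (fun ε : ℝ => 1 / ε ^ p) := by
    refine hs.congr' ?_ EventuallyEq.rfl
    filter_upwards [self_mem_nhdsWithin] with ε hε using hdim ε hε
  obtain ⟨c, hc, h⟩ := exists_finset_card_ge hl hsum hpos hp hO (C := 12000) (by norm_num)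
  refine ⟨c / 4, by positivity, fun ε₀ hε₀ => ?_⟩
  obtain ⟨ε, hε, hεε₀, F, hF, hcard⟩ := h ε₀ hε₀
  refine ⟨ε, hε, hεε₀, ?_, fun C A r hsolve hmost => ?_⟩
  · rw [hdim ε hε]
    exact tsum_div_add_pos hl hsum hpos hε
  · have h1 := card_eigenvalues_le v.orthonormal hK hε F hF A hsolve hmost
    have h2 : (F.card : ℝ) ≤ 4 * r := by exact_mod_cast h1
    rw [hdim ε hε]
    linarith

end LowerBound

theorem mainTheorem9 (μ : Measure ℝ) [IsProbabilityMeasure μ] (T : ℝ) (hT : 0 < T)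
    (p : ℝ) (hp : p < 1)
    (hs : (fun ε : ℝ => statDim μ T ε) =O[𝓝[>] 0] (fun ε : ℝ => 1 / ε ^ p)) :
    (∀ C : ℝ, 1 ≤ C → ∀ (A : ℝ → QueryAlgorithm.{u} T) (r : ℝ → ℕ),
      (∀ ε : ℝ, 0 < ε → (A ε).Solves μ C ε ∧ (A ε).MakesAtMost μ (r ε)) →
        IsHardyLittlewoodOmega (fun ε => (r ε : ℝ)) (fun ε => statDim μ T ε)) ∧
    (∃ c : ℝ, 0 < c ∧ ∀ ε₀ : ℝ, 0 < ε₀ → ∃ ε : ℝ, 0 < ε ∧ ε < ε₀ ∧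
      ∀ C : ℝ, 1 ≤ C → ∀ (A : QueryAlgorithm.{u} T) (r : ℕ),
        A.Solves μ C ε → A.MakesAtMost μ r → c * statDim μ T ε ≤ (r : ℝ)) := by
  obtain ⟨c, hc, h⟩ := exists_const_mul_statDim_le.{u} hT hp hs
  refine ⟨fun C _ A r hA => ?_, c, hc, fun ε₀ hε₀ => ?_⟩
  -- The bound is known only at arbitrarily small scales; holding frequently is enough for a lower
  -- bound on the `limsup`.
  · have hfreq : ∃ᶠ ε in 𝓝[>] (0 : ℝ), (c : EReal) ≤ ((r ε / statDim μ T ε : ℝ) : EReal) := by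
      intro hev
      obtain ⟨ε₀, hε₀, hsub⟩ := mem_nhdsGT_iff_exists_Ioo_subset.1 hev
      obtain ⟨ε, hε, hεε₀, hdim, hle⟩ := h ε₀ hε₀
      refine hsub ⟨hε, hεε₀⟩ (EReal.coe_le_coe_iff.2 ?_)
      rw [le_div_iff₀ hdim]
      exact hle C (A ε) (r ε) (hA ε hε).1 (hA ε hε).2
    exact lt_of_lt_of_le (EReal.coe_pos.2 hc) (le_limsup_of_frequently_le hfreq)
  · obtain ⟨ε, hε, hεε₀, -, hle⟩ := h ε₀ hε₀
    exact ⟨ε, hε, hεε₀, fun C _ => hle C⟩
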